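/- Consider the third-order partial differential equation $$f_{xxx}\,f_{yyy}-f_{xxy}\,f_{xyy}-1=0 \qquad (\ast)$$ for a real function $f(x,y)$. Let $U$ be a nonempty connected open subset of $\mathbb R^3$ with coordinates $(x,y,f)$ (for example $U=\mathbb R^3$), and consider the Lie algebra of $C^\infty$ vector fields $\mathbf v=\xi(x,y,f)\partial_x+\eta(x,y,f)\partial_y+\phi(x,y,f)\partial_f$ on $U$ under the commutator. Such a field is called a (classical infinitesimal) Lie point symmetry of $(\ast)$ if near every point of $U$ it generates a smooth local one-parameter group of transformations $\Phi_t$ that leaves the set of solutions invariant: whenever $u$ is a smooth solution of $(\ast)$ on an open subset of $\mathbb R^2$ whose graph lies in the domain of $\Phi_t$, and a piece of the image of this graph under $\Phi_t$ is the graph of a smooth function $\tilde u$ on an open subset of $\mathbb R^2$, then $\tilde u$ is also a solution of $(\ast)$. Then the Lie point symmetries of $(\ast)$ on $U$ form a Lie algebra of dimension exactly ten. It is spanned over $\mathbb R$ by (the restrictions to $U$ of) $$\mathbf v_1=\partial_x,\quad \mathbf v_2=\partial_y,\quad \mathbf v_3=x\partial_x+\tfrac32 f\partial_f,\quad \mathbf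 v_4=y\partial_y+\tfrac32 f\partial_f,$$ $$\mathbf v_5=xy\,\partial_f,\quad \mathbf v_6=x^2\partial_f,\quad \mathbf v_7=y^2\partial_f,\quad \mathbf v_8=x\,\partial_f,\quad \mathbf v_9=y\,\partial_f,\quad \mathbf v_{10}=\partial_f .$$ Commutators: $[\mathbf v_1,\mathbf v_3]=\mathbf v_1$, $[\mathbf v_1,\mathbf v_5]=\mathbf v_9$, $[\mathbf v_1,\mathbf v_6]=2\mathbf v_8$, $[\mathbf v_1,\mathbf v_8]=\mathbf v_{10}$; $[\mathbf v_2,\mathbf v_4]=\mathbf v_2$, $[\mathbf v_2,\mathbf v_5]=\mathbf v_8$, $[\mathbf v_2,\mathbf v_7]=2\mathbf v_9$, $[\mathbf v_2,\mathbf v_9]=\mathbf v_{10}$; $[\mathbf v_3,\mathbf v_5]=-\tfrac12\mathbf v_5$, $[\mathbf v_3,\mathbf v_6]=\tfrac12\mathbf v_6$, $[\mathbf v_3,\mathbf v_7]=-\tfrac32\mathbf v_7$, $[\mathbf v_3,\mathbf v_8]=-\tfrac12\mathbf v_8$, $[\mathbf v_3,\mathbf v_9]=-\tfrac32\mathbf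 v_9$, $[\mathbf v_3,\mathbf v_{10}]=-\tfrac32\mathbf v_{10}$; $[\mathbf v_4,\mathbf v_5]=-\tfrac12\mathbf v_5$, $[\mathbf v_4,\mathbf v_6]=-\tfrac32\mathbf v_6$, $[\mathbf v_4,\mathbf v_7]=\tfrac12\mathbf v_7$, $[\mathbf v_4,\mathbf v_8]=-\tfrac32\mathbf v_8$, $[\mathbf v_4,\mathbf v_9]=-\tfrac12\mathbf v_9$, $[\mathbf v_4,\mathbf v_{10}]=-\tfrac32\mathbf v_{10}$; and all other $[\mathbf v_i,\mathbf v_j]$ with $i<j$ vanish. Adjoint actions: for $\varepsilon\in\mathbb R$ let $$\mathrm{Ad}(e^{\varepsilon\mathbf v})\mathbf w=\mathbf w-\varepsilon[\mathbf v,\mathbf w]+\tfrac{\varepsilon^2}{2!}[\mathbf v,[\mathbf v,\mathbf w]]-\cdots$$ (the series converges pointwise for $\mathbf v,\mathbf w$ among the $\mathbf v_i$). Write $A_i=\mathrm{Ad}(e^{\varepsilon\mathbf v_i})$. Then $A_i\mathbf v_j=\mathbf v_j$ except for the following. - $A_1\mathbf v_3=\mathbf v_3-\varepsilon\mathbf v_1$,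 $A_1\mathbf v_5=\mathbf v_5-\varepsilon\mathbf v_9$, $A_1\mathbf v_6=\mathbf v_6-2\varepsilon\mathbf v_8+\varepsilon^2\mathbf v_{10}$, $A_1\mathbf v_8=\mathbf v_8-\varepsilon\mathbf v_{10}$. - $A_2\mathbf v_4=\mathbf v_4-\varepsilon\mathbf v_2$, $A_2\mathbf v_5=\mathbf v_5-\varepsilon\mathbf v_8$, $A_2\mathbf v_7=\mathbf v_7-2\varepsilon\mathbf v_9+\varepsilon^2\mathbf v_{10}$, $A_2\mathbf v_9=\mathbf v_9-\varepsilon\mathbf v_{10}$. - $A_3\mathbf v_1=e^{\varepsilon}\mathbf v_1$, $A_3\mathbf v_5=e^{\varepsilon/2}\mathbf v_5$, $A_3\mathbf v_6=e^{-\varepsilon/2}\mathbf v_6$, $A_3\mathbf v_8=e^{\varepsilon/2}\mathbf v_8$, and $A_3\mathbf v_j=e^{3\varepsilon/2}\mathbf v_j$ for $j=7,9,10$. - $A_4\mathbf v_2=e^{\varepsilon}\mathbf v_2$, $A_4\mathbf v_5=e^{\varepsilon/2}\mathbf v_5$, $A_4\mathbf v_7=e^{-\varepsilon/2}\mathbf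 v_7$, $A_4\mathbf v_9=e^{\varepsilon/2}\mathbf v_9$, and $A_4\mathbf v_j=e^{3\varepsilon/2}\mathbf v_j$ for $j=6,8,10$. - $A_5\mathbf v_1=\mathbf v_1+\varepsilon\mathbf v_9$, $A_5\mathbf v_2=\mathbf v_2+\varepsilon\mathbf v_8$, $A_5\mathbf v_3=\mathbf v_3-\tfrac12\varepsilon\mathbf v_5$, $A_5\mathbf v_4=\mathbf v_4-\tfrac12\varepsilon\mathbf v_5$. - $A_6\mathbf v_1=\mathbf v_1+2\varepsilon\mathbf v_8$, $A_6\mathbf v_3=\mathbf v_3+\tfrac12\varepsilon\mathbf v_6$, $A_6\mathbf v_4=\mathbf v_4-\tfrac32\varepsilon\mathbf v_6$. - $A_7\mathbf v_2=\mathbf v_2+2\varepsilon\mathbf v_9$, $A_7\mathbf v_3=\mathbf v_3-\tfrac32\varepsilon\mathbf v_7$, $A_7\mathbf v_4=\mathbf v_4+\tfrac12\varepsilon\mathbf v_7$. - $A_8\mathbf v_1=\mathbf v_1+\varepsilon\mathbf v_{10}$, $A_8\mathbf v_3=\mathbf v_3-\tfrac12\varepsilon\mathbf v_8$, $A_8\mathbf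 v_4=\mathbf v_4-\tfrac32\varepsilon\mathbf v_8$. - $A_9\mathbf v_2=\mathbf v_2+\varepsilon\mathbf v_{10}$, $A_9\mathbf v_3=\mathbf v_3-\tfrac32\varepsilon\mathbf v_9$, $A_9\mathbf v_4=\mathbf v_4-\tfrac12\varepsilon\mathbf v_9$. - $A_{10}\mathbf v_3=\mathbf v_3-\tfrac32\varepsilon\mathbf v_{10}$, $A_{10}\mathbf v_4=\mathbf v_4-\tfrac32\varepsilon\mathbf v_{10}$. -/

import Mathlib

open Set Topology TopologicalSpace
open scoped ContDiff Nat

/-! ### The partial differential equation -/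

/-- The partial derivative `∂u/∂x` of a function `u` of `(x, y)`. -/
noncomputable def partialX (u : ℝ × ℝ → ℝ) : ℝ × ℝ → ℝ :=
  fun q => fderiv ℝ u q (1, 0)

/-- The partial derivative `∂u/∂y` of a function `u` of `(x, y)`. -/
noncomputable def partialY (u : ℝ × ℝ → ℝ) : ℝ × ℝ → ℝ :=
  fun q => fderiv ℝ u q (0, 1)

/-- `u` is a smooth solution of `u_xxx u_yyy - u_xxy u_xyy - 1 = 0` on the open set `W`. -/
def IsSolutionOn (W : Set (ℝ × ℝ)) (u : ℝ × ℝ → ℝ) : Prop :=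
  IsOpen W ∧ ContDiffOn ℝ ∞ u W ∧
    ∀ q ∈ W,
      partialX (partialX (partialX u)) q * partialY (partialY (partialY u)) q
        - partialY (partialX (partialX u)) q * partialY (partialY (partialX u)) q - 1 = 0

/-! ### The Lie algebra of smooth vector fields on an open set of `(x, y, f)`-space -/

/-- The space with coordinates `(x, y, f)`: one reads `p.1`, `p.2.1`, `p.2.2`. -/
abbrev PointSpace : Type := ℝ × ℝ × ℝ

/-- The smooth vector fields `ξ ∂x + η ∂y + φ ∂f` on the open set `U`. The field is the function
`p ↦ (ξ p, η p, φ p)` on `U`; it is given the value `0` outside of `U`, so that two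
fields are equal exactly when they agree on `U`. -/
def smoothVectorFields (U : Opens PointSpace) : Submodule ℝ (PointSpace → PointSpace) where
  carrier := {v | ContDiffOn ℝ ∞ v U ∧ ∀ p ∉ U, v p = 0}
  add_mem' := by
    rintro v w ⟨hv, hv0⟩ ⟨hw, hw0⟩
    exact ⟨hv.add hw, fun p hp => by simp [hv0 p hp, hw0 p hp]⟩
  zero_mem' := ⟨contDiffOn_const, fun _ _ => rfl⟩
  smul_mem' := by
    rintro c v ⟨hv, hv0⟩
    exact ⟨hv.const_smul c, fun p hp => by simp [hv0 p hp]⟩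

/-- The restriction to `U` of a vector field that is smooth on the whole space. -/
noncomputable def restrictField (U : Opens PointSpace) (g : PointSpace → PointSpace)
    (hg : ContDiff ℝ ∞ g) : smoothVectorFields U :=
  ⟨(U : Set PointSpace).indicator g,
    hg.contDiffOn.congr fun _ hp => indicator_of_mem hp g,
    fun _ hp => indicator_of_notMem hp g⟩

theorem smoothVectorFields_contDiffAt {U : Opens PointSpace} (v : smoothVectorFields U)
    {p : PointSpace} (hp : p ∈ U) : ContDiffAt ℝ ∞ (v : PointSpace → PointSpace) p :=
  v.2.1.contDiffAt (U.2.mem_nhds hp)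

theorem smoothVectorFields_differentiableAt {U : Opens PointSpace} (v : smoothVectorFields U)
    {p : PointSpace} (hp : p ∈ U) : DifferentiableAt ℝ (v : PointSpace → PointSpace) p :=
  (smoothVectorFields_contDiffAt v hp).differentiableAt (by simp)

theorem smoothVectorFields_ext {U : Opens PointSpace} {v w : smoothVectorFields U}
    (h : ∀ p ∈ U, (v : PointSpace → PointSpace) p = (w : PointSpace → PointSpace) p) :
    v = w := by
  apply Subtype.ext
  funext p
  by_cases hp : p ∈ U
  · exact h p hp
  · rw [v.2.2 p hp, w.2.2 p hp]

/-- The commutator `[v, w]` of two vector fields on `U`: in coordinates,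
`[v, w]^k = ∑ l, (v^l ∂_l w^k - w^l ∂_l v^k)`. -/
noncomputable instance smoothVectorFieldsBracket (U : Opens PointSpace) :
    Bracket (smoothVectorFields U) (smoothVectorFields U) where
  bracket v w :=
    ⟨(U : Set PointSpace).indicator (VectorField.lieBracket ℝ
        (v : PointSpace → PointSpace) (w : PointSpace → PointSpace)), by
      refine ⟨?_, fun _ hp => indicator_of_notMem hp _⟩
      refine ContDiffOn.congr ?_ fun _ hp => indicator_of_mem hp _
      intro p hp
      exact ((smoothVectorFields_contDiffAt v hp).lieBracket_vectorField
        (smoothVectorFields_contDiffAt w hp) (by simp)).contDiffWithinAt⟩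

theorem bracket_apply {U : Opens PointSpace} (v w : smoothVectorFields U) {p : PointSpace}
    (hp : p ∈ U) : (⁅v, w⁆ : smoothVectorFields U).1 p = VectorField.lieBracket ℝ v.1 w.1 p :=
  indicator_of_mem (s := (U : Set PointSpace)) hp _

theorem bracket_eventuallyEq {U : Opens PointSpace} (v w : smoothVectorFields U)
    {p : PointSpace} (hp : p ∈ U) :
    (⁅v, w⁆ : smoothVectorFields U).1 =ᶠ[𝓝 p] VectorField.lieBracket ℝ v.1 w.1 := by
  filter_upwards [U.2.mem_nhds hp] with q hq using bracket_apply v w hq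

noncomputable instance smoothVectorFieldsLieRing (U : Opens PointSpace) :
    LieRing (smoothVectorFields U) where
  add_lie a b c := smoothVectorFields_ext fun p hp => by
    have := VectorField.lieBracket_add_left (W := c.1)
      (smoothVectorFields_differentiableAt a hp) (smoothVectorFields_differentiableAt b hp)
    simpa [bracket_apply _ _ hp] using this
  lie_add a b c := smoothVectorFields_ext fun p hp => by
    have := VectorField.lieBracket_add_right (V := a.1)
      (smoothVectorFields_differentiableAt b hp) (smoothVectorFields_differentiableAt c hp)
    simpa [bracket_apply _ _ hp] using this
  lie_self a := smoothVectorFields_ext fun p hp => by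
    simp [bracket_apply _ _ hp]
  leibniz_lie a b c := smoothVectorFields_ext fun p hp => by
    have h := VectorField.leibniz_identity_lieBracket (n := ∞) (𝕜 := ℝ)
      (by simpa using WithTop.coe_le_coe.2 (le_top : (2 : ℕ∞) ≤ ⊤))
      (smoothVectorFields_contDiffAt a hp) (smoothVectorFields_contDiffAt b hp)
      (smoothVectorFields_contDiffAt c hp)
    have hrefl : ∀ v : smoothVectorFields U, v.1 =ᶠ[𝓝 p] v.1 := fun v => Filter.EventuallyEq.rfl
    rw [bracket_apply _ _ hp, Submodule.coe_add, Pi.add_apply, bracket_apply _ _ hp,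
      bracket_apply _ _ hp,
      (hrefl a).lieBracket_vectorField_eq (bracket_eventuallyEq b c hp),
      (bracket_eventuallyEq a b hp).lieBracket_vectorField_eq (hrefl c),
      (hrefl b).lieBracket_vectorField_eq (bracket_eventuallyEq a c hp)]
    exact h

noncomputable instance smoothVectorFieldsLieAlgebra (U : Opens PointSpace) :
    LieAlgebra ℝ (smoothVectorFields U) where
  lie_smul t a b := smoothVectorFields_ext fun p hp => by
    have := VectorField.lieBracket_const_smul_right (c := t) (V := a.1)
      (smoothVectorFields_differentiableAt b hp)
    simpa [bracket_apply _ _ hp] using this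

/-! ### Lie point symmetries -/

/-- `Φ` is a smooth local one-parameter group of transformations of `U` with infinitesimal
generator `v` (a local flow of `v`), defined for the points of the open set `N` and for
`|t| < δ`. -/
def IsLocalFlow (U : Opens PointSpace) (v : PointSpace → PointSpace) (N : Set PointSpace)
    (δ : ℝ) (Φ : ℝ → PointSpace → PointSpace) : Prop :=
  IsOpen N ∧ 0 < δ ∧
    ContDiffOn ℝ ∞ (fun z : ℝ × PointSpace => Φ z.1 z.2) (Ioo (-δ) δ ×ˢ N) ∧
    (∀ p ∈ N, Φ 0 p = p) ∧
    ∀ p ∈ N, ∀ t ∈ Ioo (-δ) δ, Φ t p ∈ U ∧ HasDerivAt (fun s => Φ s p) (v (Φ t p)) t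

/-- The point transformation `T`, defined on `N`, takes solutions to solutions: if the graph of
the solution `u` lies in `N`, and if (a piece of) its image under `T` is the graph of a
smooth function `u'`, then `u'` is a solution. -/
def PreservesSolutions (N : Set PointSpace) (T : PointSpace → PointSpace) : Prop :=
  ∀ (W W' : Set (ℝ × ℝ)) (u u' : ℝ × ℝ → ℝ),
    IsSolutionOn W u → (∀ q ∈ W, ((q.1, q.2, u q) : PointSpace) ∈ N) →
    IsOpen W' → ContDiffOn ℝ ∞ u' W' →
    (∀ q' ∈ W', ∃ q ∈ W, T (q.1, q.2, u q) = (q'.1, q'.2, u' q')) →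
    IsSolutionOn W' u'

/-- The vector field `v` on `U` is an infinitesimal (classical) Lie point symmetry of the
equation: near every point of `U`, it generates a local one-parameter group of
transformations that takes solutions to solutions. -/
def IsPointSymmetry (U : Opens PointSpace) (v : smoothVectorFields U) : Prop :=
  ∀ p ∈ U, ∃ (N : Set PointSpace) (δ : ℝ) (Φ : ℝ → PointSpace → PointSpace),
    p ∈ N ∧ IsLocalFlow U v.1 N δ Φ ∧ ∀ t ∈ Ioo (-δ) δ, PreservesSolutions N (Φ t)

/-! ### The generators and the tables -/

/-- The ten vector fields, as functions on the whole space: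
`∂x`, `∂y`, `x ∂x + (3/2) f ∂f`, `y ∂y + (3/2) f ∂f`,
`x y ∂f`, `x² ∂f`, `y² ∂f`, `x ∂f`, `y ∂f`, `∂f`. -/
noncomputable def generatorFun : Fin 10 → PointSpace → PointSpace :=
  ![fun _ => (1, 0, 0),
    fun _ => (0, 1, 0),
    fun p => (p.1, 0, 3 / 2 * p.2.2),
    fun p => (0, p.2.1, 3 / 2 * p.2.2),
    fun p => (0, 0, p.1 * p.2.1),
    fun p => (0, 0, p.1 ^ 2),
    fun p => (0, 0, p.2.1 ^ 2),
    fun p => (0, 0, p.1),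
    fun p => (0, 0, p.2.1),
    fun _ => (0, 0, 1)]

theorem generatorFun_contDiff (i : Fin 10) : ContDiff ℝ ∞ (generatorFun i) := by
  fin_cases i <;> simp [generatorFun] <;> fun_prop

/-- The ten vector fields on `U`; the field `v_k` of the usual numbering `v_1, …, v_10` is
`generator U (k - 1)`. -/
noncomputable def generator (U : Opens PointSpace) (i : Fin 10) : smoothVectorFields U :=
  restrictField U (generatorFun i) (generatorFun_contDiff i)

set_option linter.unusedVariables false in
/-- The commutator table: row `v_i`, column `v_j` holds `[v_i, v_j]`. -/
noncomputable def commutatorTable {M : Type*} [AddCommGroup M] [Module ℝ M]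
    (v₁ v₂ v₃ v₄ v₅ v₆ v₇ v₈ v₉ v₁₀ : M) : Matrix (Fin 10) (Fin 10) M :=
  !![0, 0, v₁, 0, v₉, (2 : ℝ) • v₈, 0, v₁₀, 0, 0;
     0, 0, 0, v₂, v₈, 0, (2 : ℝ) • v₉, 0, v₁₀, 0;
     -v₁, 0, 0, 0, -(1 / 2 : ℝ) • v₅, (1 / 2 : ℝ) • v₆, -(3 / 2 : ℝ) • v₇, -(1 / 2 : ℝ) • v₈,
       -(3 / 2 : ℝ) • v₉, -(3 / 2 : ℝ) • v₁₀;
     0, -v₂, 0, 0, -(1 / 2 : ℝ) • v₅, -(3 / 2 : ℝ) • v₆, (1 / 2 : ℝ) • v₇, -(3 / 2 : ℝ) • v₈,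
       -(1 / 2 : ℝ) • v₉, -(3 / 2 : ℝ) • v₁₀;
     -v₉, -v₈, (1 / 2 : ℝ) • v₅, (1 / 2 : ℝ) • v₅, 0, 0, 0, 0, 0, 0;
     -(2 : ℝ) • v₈, 0, -(1 / 2 : ℝ) • v₆, (3 / 2 : ℝ) • v₆, 0, 0, 0, 0, 0, 0;
     0, -(2 : ℝ) • v₉, (3 / 2 : ℝ) • v₇, -(1 / 2 : ℝ) • v₇, 0, 0, 0, 0, 0, 0;
     -v₁₀, 0, (1 / 2 : ℝ) • v₈, (3 / 2 : ℝ) • v₈, 0, 0, 0, 0, 0, 0;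
     0, -v₁₀, (3 / 2 : ℝ) • v₉, (1 / 2 : ℝ) • v₉, 0, 0, 0, 0, 0, 0;
     0, 0, (3 / 2 : ℝ) • v₁₀, (3 / 2 : ℝ) • v₁₀, 0, 0, 0, 0, 0, 0]

set_option linter.unusedVariables false in
/-- The adjoint table with parameter `ε`: row `v_i`, column `v_j` holds `Ad(exp(ε v_i)) v_j`. -/
noncomputable def adjointTable {M : Type*} [AddCommGroup M] [Module ℝ M] (ε : ℝ)
    (v₁ v₂ v₃ v₄ v₅ v₆ v₇ v₈ v₉ v₁₀ : M) : Matrix (Fin 10) (Fin 10) M :=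
  !![v₁, v₂, v₃ - ε • v₁, v₄, v₅ - ε • v₉, v₆ - (2 * ε) • v₈ + ε ^ 2 • v₁₀, v₇, v₈ - ε • v₁₀,
       v₉, v₁₀;
     v₁, v₂, v₃, v₄ - ε • v₂, v₅ - ε • v₈, v₆, v₇ - (2 * ε) • v₉ + ε ^ 2 • v₁₀, v₈,
       v₉ - ε • v₁₀, v₁₀;
     Real.exp ε • v₁, v₂, v₃, v₄, Real.exp (ε / 2) • v₅, Real.exp (-ε / 2) • v₆,
       Real.exp (3 * ε / 2) • v₇, Real.exp (ε / 2) • v₈, Real.exp (3 * ε / 2) • v₉,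
       Real.exp (3 * ε / 2) • v₁₀;
     v₁, Real.exp ε • v₂, v₃, v₄, Real.exp (ε / 2) • v₅, Real.exp (3 * ε / 2) • v₆,
       Real.exp (-ε / 2) • v₇, Real.exp (3 * ε / 2) • v₈, Real.exp (ε / 2) • v₉,
       Real.exp (3 * ε / 2) • v₁₀;
     v₁ + ε • v₉, v₂ + ε • v₈, v₃ - (1 / 2 * ε) • v₅, v₄ - (1 / 2 * ε) • v₅,
       v₅, v₆, v₇, v₈, v₉, v₁₀;
     v₁ + (2 * ε) • v₈, v₂, v₃ + (1 / 2 * ε) • v₆, v₄ - (3 / 2 * ε) • v₆,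
       v₅, v₆, v₇, v₈, v₉, v₁₀;
     v₁, v₂ + (2 * ε) • v₉, v₃ - (3 / 2 * ε) • v₇, v₄ + (1 / 2 * ε) • v₇,
       v₅, v₆, v₇, v₈, v₉, v₁₀;
     v₁ + ε • v₁₀, v₂, v₃ - (1 / 2 * ε) • v₈, v₄ - (3 / 2 * ε) • v₈,
       v₅, v₆, v₇, v₈, v₉, v₁₀;
     v₁, v₂ + ε • v₁₀, v₃ - (3 / 2 * ε) • v₉, v₄ - (1 / 2 * ε) • v₉,
       v₅, v₆, v₇, v₈, v₉, v₁₀;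
     v₁, v₂, v₃ - (3 / 2 * ε) • v₁₀, v₄ - (3 / 2 * ε) • v₁₀,
       v₅, v₆, v₇, v₈, v₉, v₁₀]

/-- `w' = Ad(exp(ε v)) w`: the Lie series
`w - ε [v, w] + (ε² / 2!) [v, [v, w]] - (ε³ / 3!) [v, [v, [v, w]]] + ⋯`
converges to `w'` at every point. -/
def IsAdjointAction {U : Opens PointSpace} (ε : ℝ) (v w w' : smoothVectorFields U) : Prop :=
  ∀ p : PointSpace,
    HasSum (fun n : ℕ => ((-ε) ^ n / (n ! : ℝ)) •
      (((LieAlgebra.ad ℝ (smoothVectorFields U) v) ^ n) w).1 p) (w'.1 p)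

/-! Write `ξ`, `η`, `ζ` for the three components of a field `v`. If the flow of `v` permutes
solutions, then along every solution `u` the characteristic `ζ - ξ u_x - η u_y` solves the equation
linearized at `u`. The definition of a symmetry only speaks of finite transformations, so this has
to be derived: by the inverse function theorem the transported graphs of `u` are locally graphs of a
smooth family of solutions (`exists_transported_solutions`), and the derivative of the equation
along this family at time zero is `linearized_equation`.

A cubic polynomial whose third-order Taylor coefficients `a, b, c, d` satisfy `a d - b c = 1` is an
exact global solution, because its third derivatives are constant. Hence every third-order jet
allowed by the equation is the jet of a solution, and no existence theory is needed. Inserting these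
cubics gives `determining_equation`, in which `p, q, r, s, t` are free and `a, b, c, d` are bound
only by `a d - b c = 1`. Special values give `ξ_f = η_f = ζ_ff = 0`, `ξ_y = η_x = 0`, `ζ_f = 3/2
(ξ_x + η_y)`, then `ξ_xx = η_yy = ζ_xf = ζ_yf = 0`, and the vanishing of all third derivatives of
`ζ` in `x` and `y`. On a connected set these integrate to exactly the ten-parameter family
(`exists_eq_generatorCombo`).

Conversely, the flow of a combination of the ten fields can be written down: it scales and
translates `x` and `y`, multiplies `f` by `K` and adds a quadratic polynomial in `x, y`. Third
derivatives do not see the quadratic, and the weight `3/2` makes `K² = (A B)³`, which is what keeps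
the constant `1` in the equation fixed (`preservesSolutions_of_affine`).

In the adjoint table, `v₃` and `v₄` act diagonally, which gives exponentials; for the other fields
the third power of the adjoint map kills every generator. -/

/-! ### Directional derivatives -/

/-- The directional derivative of `g` in the direction `e`. -/
noncomputable def dirDeriv {E : Type*} [NormedAddCommGroup E] [NormedSpace ℝ E] (e : E)
    (g : E → ℝ) : E → ℝ :=
  fun p => fderiv ℝ g p e

section DirDeriv

variable {E : Type*} [NormedAddCommGroup E] [NormedSpace ℝ E]

theorem ContDiffOn.dirDeriv {U : Set E} (hU : IsOpen U) {g : E → ℝ} (hg : ContDiffOn ℝ ∞ g U)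
    (e : E) : ContDiffOn ℝ ∞ (dirDeriv e g) U :=
  (hg.fderiv_of_isOpen hU (m := ∞) (by simp)).clm_apply contDiffOn_const

theorem dirDeriv_congr {U : Set E} (hU : IsOpen U) {g h : E → ℝ} (hgh : EqOn g h U) (e : E) :
    EqOn (dirDeriv e g) (dirDeriv e h) U := fun p hp => by
  have : g =ᶠ[𝓝 p] h := Filter.eventuallyEq_of_mem (hU.mem_nhds hp) hgh
  simp [dirDeriv, this.fderiv_eq]

theorem dirDeriv_zero_of_eqOn {U : Set E} (hU : IsOpen U) {g : E → ℝ} (hg : EqOn g 0 U) (e : E) :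
    EqOn (dirDeriv e g) 0 U := fun p hp => by
  rw [dirDeriv_congr hU hg e hp]
  simp [dirDeriv]

theorem dirDeriv_comm {U : Set E} (hU : IsOpen U) {g : E → ℝ} (hg : ContDiffOn ℝ ∞ g U)
    (e e' : E) : EqOn (dirDeriv e (dirDeriv e' g)) (dirDeriv e' (dirDeriv e g)) U := fun p hp => by
  have hgp : ContDiffAt ℝ ∞ g p := hg.contDiffAt (hU.mem_nhds hp)
  have hd : DifferentiableAt ℝ (fderiv ℝ g) p :=
    ((hg.fderiv_of_isOpen hU (m := ∞) (by simp)).contDiffAt (hU.mem_nhds hp)).differentiableAt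
      (by simp)
  have hs : IsSymmSndFDerivAt ℝ g p := hgp.isSymmSndFDerivAt
    (by simpa using WithTop.coe_le_coe.2 (le_top : (2 : ℕ∞) ≤ ⊤))
  have key : ∀ a b : E, dirDeriv a (dirDeriv b g) p = fderiv ℝ (fderiv ℝ g) p a b := by
    intro a b
    have := (hd.hasFDerivAt.clm_apply (hasFDerivAt_const b p)).fderiv
    change fderiv ℝ (fun y => fderiv ℝ g y b) p a = _
    rw [this]
    simp
  rw [key, key, hs.eq]

end DirDeriv

/-! ### Functions of two variables with prescribed partial derivatives -/

/-- On `W`, the function `F` is differentiable with the partial derivatives `Fx` and `Fy`. -/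
def HasPartialsOn (W : Set (ℝ × ℝ)) (F Fx Fy : ℝ × ℝ → ℝ) : Prop :=
  ∀ q ∈ W, HasFDerivAt F (Fx q • ContinuousLinearMap.fst ℝ ℝ ℝ +
    Fy q • ContinuousLinearMap.snd ℝ ℝ ℝ) q

namespace HasPartialsOn

variable {W : Set (ℝ × ℝ)} {F Fx Fy G Gx Gy : ℝ × ℝ → ℝ}

theorem partialX_eqOn (h : HasPartialsOn W F Fx Fy) : EqOn (partialX F) Fx W := fun q hq => by
  simp [partialX, (h q hq).fderiv]

theorem partialY_eqOn (h : HasPartialsOn W F Fx Fy) : EqOn (partialY F) Fy W := fun q hq => by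
  simp [partialY, (h q hq).fderiv]

theorem of_contDiffOn (hW : IsOpen W) (hF : ContDiffOn ℝ ∞ F W) :
    HasPartialsOn W F (partialX F) (partialY F) := fun q hq => by
  have hd := ((hF.contDiffAt (hW.mem_nhds hq)).differentiableAt (by simp)).hasFDerivAt
  exact hd.congr_fderiv (by ext <;> simp [partialX, partialY])

theorem const (c : ℝ) : HasPartialsOn W (fun _ => c) 0 0 := fun q _ => by
  simpa using hasFDerivAt_const c q

theorem fst : HasPartialsOn W Prod.fst 1 0 := fun q _ => by
  simpa using hasFDerivAt_fst (𝕜 := ℝ) (p := q)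

theorem snd : HasPartialsOn W Prod.snd 0 1 := fun q _ => by
  simpa using hasFDerivAt_snd (𝕜 := ℝ) (p := q)

theorem add (hF : HasPartialsOn W F Fx Fy) (hG : HasPartialsOn W G Gx Gy) :
    HasPartialsOn W (F + G) (Fx + Gx) (Fy + Gy) := fun q hq => by
  exact ((hF q hq).add (hG q hq)).congr_fderiv (by ext <;> simp)

theorem sub (hF : HasPartialsOn W F Fx Fy) (hG : HasPartialsOn W G Gx Gy) :
    HasPartialsOn W (F - G) (Fx - Gx) (Fy - Gy) := fun q hq => by
  exact ((hF q hq).sub (hG q hq)).congr_fderiv (by ext <;> simp)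

theorem mul (hF : HasPartialsOn W F Fx Fy) (hG : HasPartialsOn W G Gx Gy) :
    HasPartialsOn W (F * G) (Fx * G + F * Gx) (Fy * G + F * Gy) := fun q hq => by
  exact ((hF q hq).mul (hG q hq)).congr_fderiv (by ext <;> simp <;> ring)

theorem congr (hF : HasPartialsOn W F Fx Fy) (hW : IsOpen W) (h : EqOn G F W)
    (hx : EqOn Gx Fx W) (hy : EqOn Gy Fy W) : HasPartialsOn W G Gx Gy := fun q hq => by
  rw [hx hq, hy hq]
  exact (hF q hq).congr_of_eventuallyEq (Filter.eventuallyEq_of_mem (hW.mem_nhds hq) h)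

theorem mono {W' : Set (ℝ × ℝ)} (hF : HasPartialsOn W F Fx Fy) (h : W' ⊆ W) :
    HasPartialsOn W' F Fx Fy := fun q hq => hF q (h hq)

/-- The chain rule for an affine change of the two variables separately. -/
theorem comp_affine (hF : HasPartialsOn W F Fx Fy) {W' : Set (ℝ × ℝ)} (a b a' b' : ℝ)
    (h : ∀ q ∈ W', (a * q.1 + a', b * q.2 + b') ∈ W) :
    HasPartialsOn W' (fun q => F (a * q.1 + a', b * q.2 + b'))
      (fun q => a * Fx (a * q.1 + a', b * q.2 + b'))
      (fun q => b * Fy (a * q.1 + a', b * q.2 + b')) := fun q hq => by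
  have h1 : HasFDerivAt (fun q : ℝ × ℝ => (a * q.1 + a', b * q.2 + b'))
      ((a • ContinuousLinearMap.fst ℝ ℝ ℝ).prod (b • ContinuousLinearMap.snd ℝ ℝ ℝ)) q :=
    ((hasFDerivAt_fst.const_mul a).add_const a').prodMk ((hasFDerivAt_snd.const_mul b).add_const b')
  exact ((hF _ (h q hq)).comp q h1).congr_fderiv (by ext <;> simp [mul_comm])

/-- The four partial derivatives of the third order that enter the equation. -/
theorem third_partials (hW : IsOpen W) {Fxx Fxy Fyx Fyy Fxxx Fxxy Fxyx Fxyy Fyyx Fyyy : ℝ × ℝ → ℝ}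
    (h : HasPartialsOn W F Fx Fy) (hx : HasPartialsOn W Fx Fxx Fxy)
    (hy : HasPartialsOn W Fy Fyx Fyy) (hxx : HasPartialsOn W Fxx Fxxx Fxxy)
    (hxy : HasPartialsOn W Fxy Fxyx Fxyy) (hyy : HasPartialsOn W Fyy Fyyx Fyyy) :
    EqOn (partialX (partialX (partialX F))) Fxxx W ∧
    EqOn (partialY (partialX (partialX F))) Fxxy W ∧
    EqOn (partialY (partialY (partialX F))) Fxyy W ∧
    EqOn (partialY (partialY (partialY F))) Fyyy W := by
  have e1 := h.partialX_eqOn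
  have e2 := (dirDeriv_congr hW e1 (1, 0)).trans hx.partialX_eqOn
  have e3 := (dirDeriv_congr hW e1 (0, 1)).trans hx.partialY_eqOn
  have e4 := (dirDeriv_congr hW h.partialY_eqOn (0, 1)).trans hy.partialY_eqOn
  exact ⟨(dirDeriv_congr hW e2 (1, 0)).trans hxx.partialX_eqOn,
    (dirDeriv_congr hW e2 (0, 1)).trans hxx.partialY_eqOn,
    (dirDeriv_congr hW e3 (0, 1)).trans hxy.partialY_eqOn,
    (dirDeriv_congr hW e4 (0, 1)).trans hyy.partialY_eqOn⟩

end HasPartialsOn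

/-! ### The linear system of the generators -/

/-- The derivatives of the ten vector fields. -/
theorem fderiv_generatorFun (i : Fin 10) (p w : PointSpace) :
    fderiv ℝ (generatorFun i) p w =
      (![0, 0, (w.1, 0, 3 / 2 * w.2.2), (0, w.2.1, 3 / 2 * w.2.2),
        (0, 0, p.1 * w.2.1 + w.1 * p.2.1), (0, 0, 2 * p.1 * w.1), (0, 0, 2 * p.2.1 * w.2.1),
        (0, 0, w.1), (0, 0, w.2.1), 0] : Fin 10 → PointSpace) i := by
  have hx : HasFDerivAt (fun p : PointSpace => p.1) (ContinuousLinearMap.fst ℝ ℝ (ℝ × ℝ)) p :=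
    hasFDerivAt_fst
  have hyf : HasFDerivAt (fun p : PointSpace => p.2) (ContinuousLinearMap.snd ℝ ℝ (ℝ × ℝ)) p :=
    hasFDerivAt_snd
  have hy := hyf.fst
  have hf := hyf.snd
  have h0 := hasFDerivAt_const (𝕜 := ℝ) (0 : ℝ) p
  fin_cases i
  · exact (DFunLike.congr_fun
      (hasFDerivAt_const (𝕜 := ℝ) ((1, 0, 0) : PointSpace) p).fderiv w :).trans
      (by simp [mul_comm])
  · exact (DFunLike.congr_fun
      (hasFDerivAt_const (𝕜 := ℝ) ((0, 1, 0) : PointSpace) p).fderiv w :).trans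
      (by simp [mul_comm])
  · exact (DFunLike.congr_fun (hx.prodMk (h0.prodMk (hf.const_mul (3 / 2)))).fderiv w :).trans
      (by simp [mul_comm])
  · exact (DFunLike.congr_fun (h0.prodMk (hy.prodMk (hf.const_mul (3 / 2)))).fderiv w :).trans
      (by simp [mul_comm])
  · exact (DFunLike.congr_fun (h0.prodMk (h0.prodMk (hx.mul hy))).fderiv w :).trans
      (by simp [mul_comm])
  · exact (DFunLike.congr_fun (h0.prodMk (h0.prodMk (hx.pow 2))).fderiv w :).trans
      (by simp [mul_comm])
  · exact (DFunLike.congr_fun (h0.prodMk (h0.prodMk (hy.pow 2))).fderiv w :).trans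
      (by simp [mul_comm])
  · exact (DFunLike.congr_fun (h0.prodMk (h0.prodMk hx)).fderiv w :).trans
      (by simp [mul_comm])
  · exact (DFunLike.congr_fun (h0.prodMk (h0.prodMk hy)).fderiv w :).trans
      (by simp [mul_comm])
  · exact (DFunLike.congr_fun
      (hasFDerivAt_const (𝕜 := ℝ) ((0, 0, 1) : PointSpace) p).fderiv w :).trans
      (by simp [mul_comm])

theorem generator_apply (U : Opens PointSpace) (i : Fin 10) {p : PointSpace} (hp : p ∈ U) :
    (generator U i).1 p = generatorFun i p :=
  indicator_of_mem (s := (U : Set PointSpace)) hp _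

theorem bracket_generator_apply (U : Opens PointSpace) (i j : Fin 10) {p : PointSpace}
    (hp : p ∈ U) : (⁅generator U i, generator U j⁆ : smoothVectorFields U).1 p =
      fderiv ℝ (generatorFun j) p (generatorFun i p) -
        fderiv ℝ (generatorFun i) p (generatorFun j p) := by
  have h : ∀ k, (generator U k).1 =ᶠ[𝓝 p] generatorFun k := fun k =>
    Filter.eventuallyEq_of_mem (U.2.mem_nhds hp) fun q hq => generator_apply U k hq
  rw [bracket_apply _ _ hp, (h i).lieBracket_vectorField_eq (h j)]
  rfl

set_option maxHeartbeats 4000000 in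
theorem bracket_generator (U : Opens PointSpace) (i j : Fin 10) :
    ⁅generator U i, generator U j⁆ =
        commutatorTable (generator U 0) (generator U 1) (generator U 2) (generator U 3)
          (generator U 4) (generator U 5) (generator U 6) (generator U 7) (generator U 8)
          (generator U 9) i j := by
  refine smoothVectorFields_ext fun p hp => ?_
  rw [bracket_generator_apply U i j hp]
  simp only [fderiv_generatorFun]
  fin_cases i <;> fin_cases j <;>
    simp [commutatorTable, generator_apply U _ hp, generatorFun] <;> ring_nf

/-! ### The adjoint actions -/

/-- On an eigenvector the Lie series is the scalar exponential series times `w`; the alternating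
sign in the definition of the action puts `-ε` into the exponent. -/
theorem isAdjointAction_of_lie_eq_smul {U : Opens PointSpace} {v w : smoothVectorFields U} {μ : ℝ}
    (h : ⁅v, w⁆ = μ • w) (ε : ℝ) : IsAdjointAction ε v w (Real.exp (-ε * μ) • w) := by
  have hpow : ∀ n : ℕ, ((LieAlgebra.ad ℝ (smoothVectorFields U) v) ^ n) w = μ ^ n • w := by
    intro n
    induction n with
    | zero => simp
    | succ n ih => rw [pow_succ', Module.End.mul_apply, ih, map_smul, LieAlgebra.ad_apply, h,
        smul_smul, pow_succ]
  intro p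
  have := (NormedSpace.expSeries_div_hasSum_exp (𝔸 := ℝ) (-ε * μ)).smul_const (w.1 p)
  rw [← Real.exp_eq_exp_ℝ] at this
  convert this using 2 with n
  · rw [hpow, mul_pow, mul_div_right_comm, mul_smul]
    rfl
  · rfl

theorem isAdjointAction_of_lie_lie_lie_eq_zero {U : Opens PointSpace}
    {v w : smoothVectorFields U} (h : ⁅v, ⁅v, ⁅v, w⁆⁆⁆ = 0) (ε : ℝ) :
    IsAdjointAction ε v w (w - ε • ⁅v, w⁆ + (ε ^ 2 / 2) • ⁅v, ⁅v, w⁆⁆) := by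
  have hpow : ∀ n : ℕ, ((LieAlgebra.ad ℝ (smoothVectorFields U) v) ^ (n + 3)) w = 0 := by
    intro n
    rw [pow_add, Module.End.mul_apply]
    simp [pow_succ, h]
  intro p
  convert hasSum_sum_of_ne_finset_zero (s := Finset.range 3) (fun n hn => ?_) using 1
  · simp [Finset.sum_range_succ, pow_succ, sub_eq_add_neg]
  · obtain ⟨m, rfl⟩ : ∃ m, n = m + 3 := ⟨n - 3, by simp at hn; omega⟩
    rw [hpow]
    simp
  · infer_instance

theorem isAdjointAction_generator_of_eigen (U : Opens PointSpace) (ε : ℝ) {i : Fin 10}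
    (hi : i = 2 ∨ i = 3) (j : Fin 10) :
    IsAdjointAction ε (generator U i) (generator U j)
        (adjointTable ε (generator U 0) (generator U 1) (generator U 2) (generator U 3)
          (generator U 4) (generator U 5) (generator U 6) (generator U 7) (generator U 8)
          (generator U 9) i j) := by
  rcases hi with rfl | rfl
  · have h : ⁅generator U 2, generator U j⁆ = (![-1, 0, 0, 0, -(1 / 2), 1 / 2, -(3 / 2), -(1 / 2),
        -(3 / 2), -(3 / 2)] : Fin 10 → ℝ) j • generator U j := by
      rw [bracket_generator]
      fin_cases j <;> simp [commutatorTable]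
    convert isAdjointAction_of_lie_eq_smul h ε using 1
    fin_cases j <;> simp [adjointTable] <;> ring_nf
  · have h : ⁅generator U 3, generator U j⁆ = (![0, -1, 0, 0, -(1 / 2), -(3 / 2), 1 / 2, -(3 / 2),
        -(1 / 2), -(3 / 2)] : Fin 10 → ℝ) j • generator U j := by
      rw [bracket_generator]
      fin_cases j <;> simp [commutatorTable]
    convert isAdjointAction_of_lie_eq_smul h ε using 1
    fin_cases j <;> simp [adjointTable] <;> ring_nf

set_option maxHeartbeats 4000000 in
theorem isAdjointAction_generator_of_nilpotent (U : Opens PointSpace) (ε : ℝ) {i : Fin 10}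
    (hi : i ≠ 2 ∧ i ≠ 3) (j : Fin 10) :
    IsAdjointAction ε (generator U i) (generator U j)
        (adjointTable ε (generator U 0) (generator U 1) (generator U 2) (generator U 3)
          (generator U 4) (generator U 5) (generator U 6) (generator U 7) (generator U 8)
          (generator U 9) i j) := by
  have h : ⁅generator U i, ⁅generator U i, ⁅generator U i, generator U j⁆⁆⁆ = 0 := by
    rw [bracket_generator U i j]
    -- The two excluded values of `i` are discharged by `hi`; each remaining case is read off the
    -- commutator table.
    fin_cases i <;> first | simp at hi; done | skip
    all_goals fin_cases j <;> simp [commutatorTable, bracket_generator]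
  convert isAdjointAction_of_lie_lie_lie_eq_zero h ε using 1
  rw [bracket_generator U i j]
  clear h
  fin_cases i <;> first | simp at hi; done | skip
  all_goals fin_cases j <;> simp [adjointTable, commutatorTable, bracket_generator] <;> module

theorem isAdjointAction_generator (U : Opens PointSpace) (ε : ℝ) (i j : Fin 10) :
    IsAdjointAction ε (generator U i) (generator U j)
        (adjointTable ε (generator U 0) (generator U 1) (generator U 2) (generator U 3)
          (generator U 4) (generator U 5) (generator U 6) (generator U 7) (generator U 8)
          (generator U 9) i j) := by
  by_cases hi : i = 2 ∨ i = 3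
  · exact isAdjointAction_generator_of_eigen U ε hi j
  · exact isAdjointAction_generator_of_nilpotent U ε (not_or.1 hi) j

/-! ### Linear combinations of the generators -/

/-- The linear combination of the ten vector fields with the coefficients `c`. -/
noncomputable def generatorCombo (c : Fin 10 → ℝ) : PointSpace → PointSpace := fun p =>
  (c 0 + c 2 * p.1, c 1 + c 3 * p.2.1,
    3 / 2 * (c 2 + c 3) * p.2.2 + (c 4 * (p.1 * p.2.1) + c 5 * p.1 ^ 2 + c 6 * p.2.1 ^ 2 +
      c 7 * p.1 + c 8 * p.2.1 + c 9))

theorem sum_smul_generator_apply (U : Opens PointSpace) (c : Fin 10 → ℝ) {p : PointSpace}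
    (hp : p ∈ U) : (∑ i, c i • generator U i).1 p = generatorCombo c p := by
  have : (∑ i, c i • generator U i).1 p = ∑ i, c i • generatorFun i p := by
    simp [generator_apply U _ hp]
  rw [this, Finset.sum_fin_eq_sum_range]
  simp only [Finset.sum_range_succ, Finset.sum_range_zero, generatorFun, generatorCombo]
  ext <;> simp <;> ring

/-- The components are polynomials of degree at most two, so finite differences on a small grid
around `p` recover the coefficients one by one. -/
theorem generatorCombo_eq_zero_of_isOpen {U : Set PointSpace} (hU : IsOpen U) {p : PointSpace}
    (hp : p ∈ U) {c : Fin 10 → ℝ} (h : ∀ q ∈ U, generatorCombo c q = 0) : c = 0 := by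
  obtain ⟨ε, hε, hball⟩ := Metric.isOpen_iff.1 hU p hp
  obtain ⟨k, hk, hkε⟩ : ∃ k, 0 < k ∧ k < ε := ⟨ε / 2, by linarith, by linarith⟩
  have hmem : ∀ i j l : ℝ, |i| ≤ 1 → |j| ≤ 1 → |l| ≤ 1 →
      generatorCombo c (p.1 + i * k, p.2.1 + j * k, p.2.2 + l * k) = 0 := by
    intro i j l hi hj hl
    apply h
    apply hball
    have hs : ∀ m : ℝ, |m| ≤ 1 → |m| * |k| < ε := fun m hm => by
      rw [abs_of_pos hk]; nlinarith
    simp [dist_eq_norm, Prod.norm_def, hs i hi, hs j hj, hs l hl]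
  simp only [generatorCombo, Prod.mk_eq_zero] at hmem
  have e00 := hmem 0 0 0 (by simp) (by simp) (by simp)
  have e10 := hmem 1 0 0 (by simp) (by simp) (by simp)
  have e01 := hmem 0 1 0 (by simp) (by simp) (by simp)
  have e11 := hmem 1 1 0 (by simp) (by simp) (by simp)
  have en0 := hmem (-1) 0 0 (by simp) (by simp) (by simp)
  have e0n := hmem 0 (-1) 0 (by simp) (by simp) (by simp)
  have cancel : ∀ {a : ℝ}, a * k = 0 → a = 0 := fun h => (mul_eq_zero.1 h).resolve_right hk.ne'
  -- First differences of the first two components isolate `c 2` and `c 3`. Once these are gone, the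
  -- third component is a quadratic in `x, y`: its mixed and pure second differences give `c 4`, `c
  -- 5`, `c 6`, and then first differences give the linear coefficients.
  have h2 : c 2 = 0 := cancel (by linear_combination e10.1 - e00.1)
  have h3 : c 3 = 0 := cancel (by linear_combination e01.2.1 - e00.2.1)
  have h0 : c 0 = 0 := by linear_combination e00.1 - (p.1 + 0 * k) * h2
  have h1 : c 1 = 0 := by linear_combination e00.2.1 - (p.2.1 + 0 * k) * h3
  simp only [h2, h3] at e00 e10 e01 e11 en0 e0n
  have h4 : c 4 = 0 := cancel (cancel (by
    linear_combination e11.2.2 - e10.2.2 - e01.2.2 + e00.2.2))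
  have h5 : c 5 = 0 := cancel (cancel (by
    linear_combination (e10.2.2 + en0.2.2 - 2 * e00.2.2) / 2))
  have h6 : c 6 = 0 := cancel (cancel (by
    linear_combination (e01.2.2 + e0n.2.2 - 2 * e00.2.2) / 2))
  simp only [h4, h5, h6] at e00 e10 e01
  have h7 : c 7 = 0 := cancel (by linear_combination e10.2.2 - e00.2.2)
  have h8 : c 8 = 0 := cancel (by linear_combination e01.2.2 - e00.2.2)
  have h9 : c 9 = 0 := by
    linear_combination e00.2.2 - (p.1 + 0 * k) * h7 - (p.2.1 + 0 * k) * h8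
  funext i
  fin_cases i <;> assumption

theorem linearIndependent_generator (U : Opens PointSpace) (hU : (U : Set PointSpace).Nonempty) :
    LinearIndependent ℝ (generator U) := by
  obtain ⟨p, hp⟩ := hU
  rw [Fintype.linearIndependent_iff]
  intro c hc i
  have : c = 0 := generatorCombo_eq_zero_of_isOpen U.2 hp fun q hq => by
    rw [← sum_smul_generator_apply U c hq, hc]
    rfl
  rw [this]
  rfl

theorem mem_span_generator_iff (U : Opens PointSpace) (v : smoothVectorFields U) :
    v ∈ Submodule.span ℝ (Set.range (generator U)) ↔
      ∃ c, ∀ p ∈ U, v.1 p = generatorCombo c p := by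
  rw [Submodule.mem_span_range_iff_exists_fun]
  constructor
  · rintro ⟨c, rfl⟩
    exact ⟨c, fun p hp => sum_smul_generator_apply U c hp⟩
  · rintro ⟨c, hc⟩
    exact ⟨c, smoothVectorFields_ext fun p hp => by
      rw [sum_smul_generator_apply U c hp, hc p hp]⟩

/-- The ten vector fields span a Lie algebra. -/
noncomputable def generatorLieSubalgebra (U : Opens PointSpace) :
    LieSubalgebra ℝ (smoothVectorFields U) where
  toSubmodule := Submodule.span ℝ (Set.range (generator U))
  lie_mem' := by
    intro v w hv hw
    have hgen : ∀ k, generator U k ∈ Submodule.span ℝ (Set.range (generator U)) := fun k =>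
      Submodule.subset_span ⟨k, rfl⟩
    induction hv, hw using Submodule.span_induction₂ with
    | mem_mem x y hx hy =>
      obtain ⟨i, rfl⟩ := hx
      obtain ⟨j, rfl⟩ := hy
      change ⁅generator U i, generator U j⁆ ∈ _
      rw [bracket_generator]
      generalize generator U = g at hgen
      fin_cases i <;> fin_cases j <;>
        -- Each entry of the table is zero or a multiple of a single generator, up to sign.
        simp [commutatorTable, hgen, Submodule.smul_mem, -neg_smul]
    | zero_left y hy => simp
    | zero_right x hx => simp
    | add_left x y z _ _ _ h1 h2 => simpa using add_mem h1 h2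
    | add_right x y z _ _ _ h1 h2 => simpa using add_mem h1 h2
    | smul_left r x y _ _ h => simpa using Submodule.smul_mem _ r h
    | smul_right r x y _ _ h => simpa using Submodule.smul_mem _ r h

/-! ### The linear combinations of the generators are point symmetries -/

/-- The cubic polynomial with the given Taylor coefficients at `(x₀, y₀)`. -/
noncomputable def cubicPoly (x₀ y₀ f p q r s t a b c d : ℝ) : ℝ × ℝ → ℝ := fun z =>
  f + p * (z.1 - x₀) + q * (z.2 - y₀) + r / 2 * (z.1 - x₀) ^ 2 + s * ((z.1 - x₀) * (z.2 - y₀)) +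
    t / 2 * (z.2 - y₀) ^ 2 + a / 6 * (z.1 - x₀) ^ 3 + b / 2 * ((z.1 - x₀) ^ 2 * (z.2 - y₀)) +
    c / 2 * ((z.1 - x₀) * (z.2 - y₀) ^ 2) + d / 6 * (z.2 - y₀) ^ 3

theorem cubicPoly_contDiff (x₀ y₀ f p q r s t a b c d : ℝ) :
    ContDiff ℝ ∞ (cubicPoly x₀ y₀ f p q r s t a b c d) := by
  unfold cubicPoly
  fun_prop

theorem cubicPoly_apply_self (x₀ y₀ f p q r s t a b c d : ℝ) :
    cubicPoly x₀ y₀ f p q r s t a b c d (x₀, y₀) = f := by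
  simp [cubicPoly]

theorem cubicPoly_const (x₀ y₀ f : ℝ) (z : ℝ × ℝ) :
    cubicPoly x₀ y₀ f 0 0 0 0 0 0 0 0 0 z = f := by
  simp [cubicPoly]

/-- The coefficients are normalized to be the derivatives at `(x₀, y₀)`, so differentiation merely
shifts them and stays inside the family. All higher partials follow by iterating this one lemma. -/
theorem HasPartialsOn.cubicPoly (W : Set (ℝ × ℝ)) (x₀ y₀ f p q r s t a b c d : ℝ) :
    HasPartialsOn W (cubicPoly x₀ y₀ f p q r s t a b c d)
      (cubicPoly x₀ y₀ p r s a b c 0 0 0 0) (cubicPoly x₀ y₀ q s t b c d 0 0 0 0) := by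
  have hx : HasPartialsOn univ (Prod.fst - fun _ => x₀) _ _ := HasPartialsOn.fst.sub (.const x₀)
  have hy : HasPartialsOn univ (Prod.snd - fun _ => y₀) _ _ := HasPartialsOn.snd.sub (.const y₀)
  have hxx := hx.mul hx
  have hxy := hx.mul hy
  have hyy := hy.mul hy
  refine HasPartialsOn.mono (HasPartialsOn.congr (((((((((HasPartialsOn.const f).add
    ((HasPartialsOn.const p).mul hx)).add ((HasPartialsOn.const q).mul hy)).add
    ((HasPartialsOn.const (r / 2)).mul hxx)).add ((HasPartialsOn.const s).mul hxy)).add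
    ((HasPartialsOn.const (t / 2)).mul hyy)).add ((HasPartialsOn.const (a / 6)).mul
    (hxx.mul hx))).add ((HasPartialsOn.const (b / 2)).mul (hxx.mul hy))).add
    ((HasPartialsOn.const (c / 2)).mul (hxy.mul hy)) |>.add
    ((HasPartialsOn.const (d / 6)).mul (hyy.mul hy))) isOpen_univ ?_ ?_ ?_) (subset_univ W)
  all_goals
    intro z _
    simp [_root_.cubicPoly]
    ring

theorem IsSolutionOn.of_partials {W : Set (ℝ × ℝ)} (hW : IsOpen W)
    {F Fx Fy Fxx Fxy Fyx Fyy Fxxx Fxxy Fxyx Fxyy Fyyx Fyyy : ℝ × ℝ → ℝ}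
    (hF : ContDiffOn ℝ ∞ F W)
    (h : HasPartialsOn W F Fx Fy) (hx : HasPartialsOn W Fx Fxx Fxy)
    (hy : HasPartialsOn W Fy Fyx Fyy) (hxx : HasPartialsOn W Fxx Fxxx Fxxy)
    (hxy : HasPartialsOn W Fxy Fxyx Fxyy) (hyy : HasPartialsOn W Fyy Fyyx Fyyy)
    (heq : ∀ q ∈ W, Fxxx q * Fyyy q - Fxxy q * Fxyy q - 1 = 0) : IsSolutionOn W F := by
  obtain ⟨h1, h2, h3, h4⟩ := HasPartialsOn.third_partials hW h hx hy hxx hxy hyy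
  refine ⟨hW, hF, fun q hq => ?_⟩
  rw [h1 hq, h2 hq, h3 hq, h4 hq, heq q hq]

theorem isSolutionOn_cubicPoly {W : Set (ℝ × ℝ)} (hW : IsOpen W)
    (x₀ y₀ f p q r s t : ℝ) {a b c d : ℝ} (h : a * d - b * c = 1) :
    IsSolutionOn W (cubicPoly x₀ y₀ f p q r s t a b c d) :=
  have hP := fun f p q r s t a b c d => HasPartialsOn.cubicPoly W x₀ y₀ f p q r s t a b c d
  .of_partials hW (cubicPoly_contDiff ..).contDiffOn (hP _ _ _ _ _ _ _ _ _ _)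
    (hP _ _ _ _ _ _ _ _ _ _) (hP _ _ _ _ _ _ _ _ _ _) (hP _ _ _ _ _ _ _ _ _ _)
    (hP _ _ _ _ _ _ _ _ _ _) (hP _ _ _ _ _ _ _ _ _ _) fun z _ => by
      simp only [cubicPoly_const]
      linear_combination h

/-- The new function is `K u` plus a quadratic, composed with the inverse `S` of the base map. The
quadratic has no third derivatives, and both products in the equation contain three derivatives in
`x` and three in `y`, so each is multiplied by `K² / (A B)³ = 1`. -/
theorem preservesSolutions_of_affine (N : Set PointSpace) (T : PointSpace → PointSpace)
    {A B K : ℝ} (α β m₄ m₅ m₆ m₇ m₈ m₉ : ℝ) (hA : A ≠ 0) (hB : B ≠ 0) (hK : K ^ 2 = (A * B) ^ 3)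
    (hT : ∀ p, T p = (A * p.1 + α, B * p.2.1 + β, K * p.2.2 +
      (m₄ * (p.1 * p.2.1) + m₅ * p.1 ^ 2 + m₆ * p.2.1 ^ 2 + m₇ * p.1 + m₈ * p.2.1 + m₉))) :
    PreservesSolutions N T := by
  rintro W W' u u' ⟨hW, hu, heq⟩ - hW' hu' himg
  set S : ℝ × ℝ → ℝ × ℝ := fun q => (A⁻¹ * q.1 + -(A⁻¹ * α), B⁻¹ * q.2 + -(B⁻¹ * β)) with hS
  have hPs := fun f p q r s t => HasPartialsOn.cubicPoly W 0 0 f p q r s t 0 0 0 0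
  have himg' : ∀ q' ∈ W', S q' ∈ W ∧ u' q' =
      K * u (S q') + cubicPoly 0 0 m₉ m₇ m₈ (2 * m₅) m₄ (2 * m₆) 0 0 0 0 (S q') := by
    intro q' hq'
    obtain ⟨q, hq, h⟩ := himg q' hq'
    rw [hT] at h
    simp only [Prod.mk.injEq] at h
    obtain ⟨h1, h2, h3⟩ := h
    have hSq : S q' = q := by
      ext
      · simp only [hS, ← h1]; field_simp; ring
      · simp only [hS, ← h2]; field_simp; ring
    rw [hSq]
    refine ⟨hq, ?_⟩
    rw [← h3]
    simp [cubicPoly]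
    ring
  have hSW : ∀ q' ∈ W', S q' ∈ W := fun q' hq' => (himg' q' hq').1
  have hux : ContDiffOn ℝ ∞ (partialX u) W := hu.dirDeriv hW (1, 0)
  have huy : ContDiffOn ℝ ∞ (partialY u) W := hu.dirDeriv hW (0, 1)
  have huxx : ContDiffOn ℝ ∞ (partialX (partialX u)) W := hux.dirDeriv hW (1, 0)
  have huxy : ContDiffOn ℝ ∞ (partialY (partialX u)) W := hux.dirDeriv hW (0, 1)
  have huyy : ContDiffOn ℝ ∞ (partialY (partialY u)) W := huy.dirDeriv hW (0, 1)
  -- One differentiation keeps the shape `k (K F + P) ∘ S` with `P` polynomial; only `k` picks up a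
  -- factor `A⁻¹` or `B⁻¹`. The same statement can therefore be applied at all three orders.
  have lift : ∀ {F Fx Fy P Px Py : ℝ × ℝ → ℝ} (k : ℝ), HasPartialsOn W F Fx Fy →
      HasPartialsOn W P Px Py → HasPartialsOn W' (fun q => k * (K * F (S q) + P (S q)))
        (fun q => k * A⁻¹ * (K * Fx (S q) + Px (S q)))
        (fun q => k * B⁻¹ * (K * Fy (S q) + Py (S q))) := by
    intro F Fx Fy P Px Py k hF hP
    refine ((HasPartialsOn.const k).mul ((((HasPartialsOn.const K).mul hF).add hP).comp_affine
      A⁻¹ B⁻¹ (-(A⁻¹ * α)) (-(B⁻¹ * β)) hSW)).congr hW' ?_ ?_ ?_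
    all_goals
      intro q _
      simp [hS]
      try ring
  have h0 : HasPartialsOn W' u' _ _ := (lift 1 (.of_contDiffOn hW hu) (hPs _ _ _ _ _ _)).congr hW'
    (fun q hq => by simp only [one_mul]; exact (himg' q hq).2) (eqOn_refl _ _) (eqOn_refl _ _)
  refine .of_partials hW' hu' h0 (lift _ (.of_contDiffOn hW hux) (hPs _ _ _ _ _ _))
    (lift _ (.of_contDiffOn hW huy) (hPs _ _ _ _ _ _))
    (lift _ (.of_contDiffOn hW huxx) (hPs _ _ _ _ _ _))
    (lift _ (.of_contDiffOn hW huxy) (hPs _ _ _ _ _ _))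
    (lift _ (.of_contDiffOn hW huyy) (hPs _ _ _ _ _ _))
    fun q hq => ?_
  simp only [cubicPoly_const]
  have hK' : A⁻¹ ^ 3 * B⁻¹ ^ 3 * K ^ 2 = 1 := by
    rw [hK]; field_simp
  linear_combination heq _ (hSW q hq) * (A⁻¹ ^ 3 * B⁻¹ ^ 3 * K ^ 2) + hK'

/-- Variation of constants. It supplies the coefficients of the explicit flow, including the case `k
= 0`, without case distinctions. -/
theorem exists_contDiff_linear_ode (k : ℝ) {g : ℝ → ℝ} (hg : ContDiff ℝ ∞ g) :
    ∃ m : ℝ → ℝ, ContDiff ℝ ∞ m ∧ m 0 = 0 ∧ ∀ t, HasDerivAt m (k * m t + g t) t := by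
  have hh : ContDiff ℝ ∞ fun s => Real.exp (-(k * s)) * g s := by fun_prop
  have hG : ∀ t, HasDerivAt (fun t => ∫ s in (0 : ℝ)..t, Real.exp (-(k * s)) * g s)
      (Real.exp (-(k * t)) * g t) t := fun t =>
    intervalIntegral.integral_hasDerivAt_right (hh.continuous.intervalIntegrable _ _)
      hh.continuous.aestronglyMeasurable.stronglyMeasurableAtFilter hh.continuous.continuousAt
  have hGs : ContDiff ℝ ∞ fun t => ∫ s in (0 : ℝ)..t, Real.exp (-(k * s)) * g s := by
    rw [contDiff_infty_iff_deriv]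
    exact ⟨fun t => (hG t).differentiableAt, by rwa [funext fun t => (hG t).deriv]⟩
  refine ⟨fun t => Real.exp (k * t) * ∫ s in (0 : ℝ)..t, Real.exp (-(k * s)) * g s, by fun_prop,
    by simp, fun t => ?_⟩
  have he : HasDerivAt (fun t => Real.exp (k * t)) (Real.exp (k * t) * (k * 1)) t :=
    ((hasDerivAt_id t).const_mul k).exp
  refine (he.mul (hG t)).congr_deriv ?_
  have : Real.exp (k * t) * Real.exp (-(k * t)) = 1 := by rw [← Real.exp_add]; simp
  linear_combination g t * this

theorem isPointSymmetry_of_eqOn_generatorCombo (U : Opens PointSpace) (v : smoothVectorFields U)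
    (c : Fin 10 → ℝ) (hv : ∀ p ∈ U, v.1 p = generatorCombo c p) : IsPointSymmetry U v := by
  intro p hp
  set κ : ℝ := 3 / 2 * (c 2 + c 3) with hκ
  have hexp : ∀ k : ℝ, ContDiff ℝ ∞ fun t => Real.exp (k * t) := fun k => by fun_prop
  have hexp' : ∀ k t : ℝ, HasDerivAt (fun t => Real.exp (k * t)) (Real.exp (k * t) * (k * 1)) t :=
    fun k t => ((hasDerivAt_id t).const_mul k).exp
  obtain ⟨A, hA⟩ : ∃ A : ℝ → ℝ, A = fun t => Real.exp (c 2 * t) := ⟨_, rfl⟩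
  obtain ⟨B, hB⟩ : ∃ B : ℝ → ℝ, B = fun t => Real.exp (c 3 * t) := ⟨_, rfl⟩
  obtain ⟨K, hK⟩ : ∃ K : ℝ → ℝ, K = fun t => Real.exp (κ * t) := ⟨_, rfl⟩
  have hAs : ContDiff ℝ ∞ A := hA ▸ hexp _
  have hBs : ContDiff ℝ ∞ B := hB ▸ hexp _
  have hKs : ContDiff ℝ ∞ K := hK ▸ hexp _
  have hAd : ∀ t, HasDerivAt A (A t * (c 2 * 1)) t := hA ▸ hexp' _
  have hBd : ∀ t, HasDerivAt B (B t * (c 3 * 1)) t := hB ▸ hexp' _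
  have hKd : ∀ t, HasDerivAt K (K t * (κ * 1)) t := hK ▸ hexp' _
  obtain ⟨α, hαs, hα0, hα⟩ := exists_contDiff_linear_ode (c 2) (contDiff_const (c := c 0))
  obtain ⟨β, hβs, hβ0, hβ⟩ := exists_contDiff_linear_ode (c 3) (contDiff_const (c := c 1))
  -- The system is triangular: `x` and `y` evolve as `A x + α` and `B y + β`, and then `f' = κ f +`
  -- a quadratic in these. Expanding that quadratic in the initial values gives the inhomogeneous
  -- terms for the coefficients of `x y`, `x²`, `y²`, `x`, `y`, `1`.
  obtain ⟨m₄, hs₄, hz₄, hd₄⟩ := exists_contDiff_linear_ode κ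
    (g := fun t => c 4 * A t * B t) (by fun_prop)
  obtain ⟨m₅, hs₅, hz₅, hd₅⟩ := exists_contDiff_linear_ode κ
    (g := fun t => c 5 * A t ^ 2) (by fun_prop)
  obtain ⟨m₆, hs₆, hz₆, hd₆⟩ := exists_contDiff_linear_ode κ
    (g := fun t => c 6 * B t ^ 2) (by fun_prop)
  obtain ⟨m₇, hs₇, hz₇, hd₇⟩ := exists_contDiff_linear_ode κ
    (g := fun t => c 4 * A t * β t + 2 * c 5 * A t * α t + c 7 * A t) (by fun_prop)
  obtain ⟨m₈, hs₈, hz₈, hd₈⟩ := exists_contDiff_linear_ode κ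
    (g := fun t => c 4 * B t * α t + 2 * c 6 * B t * β t + c 8 * B t) (by fun_prop)
  obtain ⟨m₉, hs₉, hz₉, hd₉⟩ := exists_contDiff_linear_ode κ
    (g := fun t => c 4 * α t * β t + c 5 * α t ^ 2 + c 6 * β t ^ 2 + c 7 * α t + c 8 * β t + c 9)
    (by fun_prop)
  set Φ : ℝ → PointSpace → PointSpace := fun t p => (A t * p.1 + α t, B t * p.2.1 + β t,
    K t * p.2.2 + (m₄ t * (p.1 * p.2.1) + m₅ t * p.1 ^ 2 + m₆ t * p.2.1 ^ 2 + m₇ t * p.1 +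
      m₈ t * p.2.1 + m₉ t)) with hΦ
  have hΦs : ContDiff ℝ ∞ fun z : ℝ × PointSpace => Φ z.1 z.2 := by
    simp only [hΦ]
    fun_prop
  have hΦ0 : ∀ p, Φ 0 p = p := fun p => by
    simp [hΦ, hα0, hβ0, hz₄, hz₅, hz₆, hz₇, hz₈, hz₉, hA, hB, hK]
  have hΦd : ∀ p t, HasDerivAt (fun s => Φ s p) (generatorCombo c (Φ t p)) t := by
    intro p t
    refine ((((hAd t).mul_const p.1).add (hα t)).prodMk ((((hBd t).mul_const p.2.1).add
      (hβ t)).prodMk (((hKd t).mul_const p.2.2).add (((((((hd₄ t).mul_const (p.1 * p.2.1)).add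
      ((hd₅ t).mul_const (p.1 ^ 2))).add ((hd₆ t).mul_const (p.2.1 ^ 2))).add
      ((hd₇ t).mul_const p.1)).add ((hd₈ t).mul_const p.2.1)).add (hd₉ t))))).congr_deriv ?_
    simp only [generatorCombo, hΦ, ← hκ]
    ext
    · simp only; ring
    · simp only; ring
    · simp only; ring
  -- The flow exists for all times on the whole space but must stay in `U`; continuity at `(0, p)`
  -- gives a neighbourhood and a time interval for which it does.
  have hmem : (fun z : ℝ × PointSpace => Φ z.1 z.2) ⁻¹' U ∈ 𝓝 (0, p) :=
    (hΦs.continuous.isOpen_preimage _ U.2).mem_nhds (by simpa [hΦ0] using hp)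
  obtain ⟨I, hI, N, hN, hIN⟩ := mem_nhds_prod_iff.1 hmem
  obtain ⟨δ, hδ, hδI⟩ := Metric.mem_nhds_iff.1 hI
  obtain ⟨N', hN'N, hN'o, hpN'⟩ := mem_nhds_iff.1 hN
  have hU : ∀ q ∈ N', ∀ t ∈ Ioo (-δ) δ, Φ t q ∈ U := fun q hq t ht =>
    hIN (mk_mem_prod (hδI (by rwa [Real.ball_eq_Ioo, zero_sub, zero_add])) (hN'N hq))
  refine ⟨N', δ, Φ, hpN', ⟨hN'o, hδ, hΦs.contDiffOn, fun q _ => hΦ0 q, fun q hq t ht =>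
    ⟨hU q hq t ht, ?_⟩⟩, fun t _ => ?_⟩
  · rw [hv _ (hU q hq t ht)]
    exact hΦd q t
  · refine preservesSolutions_of_affine N' _ (A := A t) (B := B t) (K := K t) (α t) (β t) (m₄ t)
      (m₅ t) (m₆ t) (m₇ t) (m₈ t) (m₉ t) ?_ ?_ ?_ fun q => rfl
    · simp [hA]
    · simp [hB]
    · simp only [hA, hB, hK, ← Real.exp_add, ← Real.exp_nat_mul, hκ]
      congr 1
      push_cast
      ring

/-! ### The linearized equation -/

theorem IsSolutionOn.mono {W W' : Set (ℝ × ℝ)} {u : ℝ × ℝ → ℝ} (h : IsSolutionOn W u)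
    (hW' : IsOpen W') (hsub : W' ⊆ W) : IsSolutionOn W' u :=
  ⟨hW', h.2.1.mono hsub, fun q hq => h.2.2 q (hsub hq)⟩

/-- The inverse function theorem gives smoothness of the inverse at the image point. Invertible
operators form an open set, so on a smaller `O` every derivative is invertible and the inverse is
smooth on all of an open `T`. -/
theorem exists_smooth_localInverse {E : Type*} [NormedAddCommGroup E] [NormedSpace ℝ E]
    [FiniteDimensional ℝ E] {D : Set E} (hD : IsOpen D) {Ψ : E → E} (hΨ : ContDiffOn ℝ ∞ Ψ D)
    {z : E} (hz : z ∈ D) (hinj : Function.Injective (fderiv ℝ Ψ z)) :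
    ∃ (O T : Set E) (κ : E → E), IsOpen O ∧ O ⊆ D ∧ z ∈ O ∧ IsOpen T ∧ ContDiffOn ℝ ∞ κ T ∧
      (∀ y ∈ T, κ y ∈ O ∧ Ψ (κ y) = y) ∧ ∀ y ∈ O, Ψ y ∈ T ∧ κ (Ψ y) = y := by
  have hcomplete : CompleteSpace E := FiniteDimensional.complete ℝ E
  have hat : ∀ y ∈ D, ContDiffAt ℝ ∞ Ψ y := fun y hy => hΨ.contDiffAt (hD.mem_nhds hy)
  have hdiff : ∀ y ∈ D, HasFDerivAt Ψ (fderiv ℝ Ψ y) y := fun y hy =>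
    ((hat y hy).differentiableAt (by simp)).hasFDerivAt
  set L : E ≃L[ℝ] E := (LinearEquiv.ofInjectiveEndo (fderiv ℝ Ψ z : E →ₗ[ℝ] E)
    hinj).toContinuousLinearEquiv with hL
  have hLz : (L : E →L[ℝ] E) = fderiv ℝ Ψ z := by
    ext y
    rfl
  set e := (hat z hz).toOpenPartialHomeomorph Ψ (hLz ▸ hdiff z hz) (by simp) with he
  have hcont : ContinuousOn (fderiv ℝ Ψ) D :=
    (hΨ.fderiv_of_isOpen hD (m := ∞) (by simp)).continuousOn
  have hinv : ∀ᶠ y in 𝓝 z, fderiv ℝ Ψ y ∈ range ((↑) : (E ≃L[ℝ] E) → E →L[ℝ] E) :=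
    (hcont.continuousAt (hD.mem_nhds hz)).eventually_mem (hLz ▸ ContinuousLinearEquiv.nhds L)
  have hsrc : e.source ∈ 𝓝 z :=
    e.open_source.mem_nhds ((hat z hz).mem_toOpenPartialHomeomorph_source _ _)
  obtain ⟨O, hO, hOo, hzO⟩ := mem_nhds_iff.1 (Filter.inter_mem (Filter.inter_mem hinv hsrc)
    (hD.mem_nhds hz))
  have heΨ : ∀ y, e y = Ψ y := fun y => rfl
  refine ⟨O, e.target ∩ e.symm ⁻¹' O, e.symm, hOo, fun y hy => (hO hy).2, hzO,
    e.isOpen_inter_preimage_symm hOo, ?_, fun y hy => ⟨hy.2, e.right_inv hy.1⟩, fun y hy => ?_⟩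
  · intro y hy
    obtain ⟨⟨⟨f', hf'⟩, hs⟩, hyD⟩ := hO hy.2
    refine (e.contDiffAt_symm hy.1 (f₀' := f') ?_ (hat _ hyD)).contDiffWithinAt
    rw [hf']
    exact hdiff _ hyD
  · have hys : y ∈ e.source := (hO hy).1.2
    refine ⟨⟨e.map_source hys, ?_⟩, e.left_inv hys⟩
    rw [mem_preimage, ← heΨ, e.left_inv hys]
    exact hy

/-- The map `Ψ` sends `(t, q)` to `t` and the base point of the transported point of the graph over
`q`. Composing its local inverse with the height of the transported point yields `w`, so each `w (t,
·)` has a piece of the transported graph as its graph. The last clause is the derivative at `t = 0`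
of the identity saying that `w ∘ Ψ` is this height. -/
theorem exists_transported_solutions {U : Opens PointSpace} {v : smoothVectorFields U}
    (hv : IsPointSymmetry U v) {p : PointSpace} (hp : p ∈ U) {u : ℝ × ℝ → ℝ}
    (hu : IsSolutionOn univ u) (hup : u (p.1, p.2.1) = p.2.2) :
    ∃ (ε : ℝ) (V : Set (ℝ × ℝ)) (T : Set PointSpace) (w : PointSpace → ℝ),
      0 < ε ∧ IsOpen V ∧ (p.1, p.2.1) ∈ V ∧ IsOpen T ∧ ContDiffOn ℝ ∞ w T ∧
      (∀ t ∈ Ioo (-ε) ε, ∀ q ∈ V, ((t, q) : PointSpace) ∈ T) ∧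
      (∀ t ∈ Ioo (-ε) ε, IsSolutionOn V fun q => w (t, q)) ∧
      (∀ q ∈ V, ((q.1, q.2, u q) : PointSpace) ∈ U ∧ w (0, q) = u q) ∧
      ∀ q ∈ V, fderiv ℝ w (0, q) (1, (v.1 (q.1, q.2, u q)).1, (v.1 (q.1, q.2, u q)).2.1) =
        (v.1 (q.1, q.2, u q)).2.2 := by
  obtain ⟨N, δ, Φ, hpN, ⟨hN, hδ, hΦs, hΦ0, hΦd⟩, hpres⟩ := hv p hp
  have hus : ContDiff ℝ ∞ u := contDiffOn_univ.1 hu.2.1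
  have h0δ : (0 : ℝ) ∈ Ioo (-δ) δ := ⟨by linarith, hδ⟩
  set γ : ℝ × ℝ → PointSpace := fun q => (q.1, q.2, u q) with hγ
  have hγs : ContDiff ℝ ∞ γ := by simp only [hγ]; fun_prop
  set W : Set (ℝ × ℝ) := γ ⁻¹' N with hWdef
  have hW : IsOpen W := hN.preimage hγs.continuous
  have hNU : ∀ y ∈ N, y ∈ U := fun y hy => by simpa [hΦ0 y hy] using (hΦd y hy 0 h0δ).1
  have hΦd0 : ∀ q ∈ W, HasDerivAt (fun s => Φ s (γ q)) (v.1 (γ q)) 0 := fun q hq => by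
    simpa [hΦ0 _ hq] using (hΦd (γ q) hq 0 h0δ).2
  set D : Set PointSpace := Ioo (-δ) δ ×ˢ W with hD
  have hDo : IsOpen D := isOpen_Ioo.prod hW
  set H : PointSpace → PointSpace := fun z => Φ z.1 (γ z.2) with hH
  have hHs : ContDiffOn ℝ ∞ H D := hΦs.comp (t := Ioo (-δ) δ ×ˢ N)
    (f := fun z : PointSpace => (z.1, γ z.2)) (by fun_prop) fun z hz => ⟨hz.1, hz.2⟩
  set Ψ : PointSpace → PointSpace := fun z => (z.1, (H z).1, (H z).2.1) with hΨ
  have hΨs : ContDiffOn ℝ ∞ Ψ D := by simp only [hΨ]; fun_prop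
  have hΨ0 : ∀ q ∈ W, Ψ (0, q) = (0, q) := fun q hq => by
    change (0, (Φ 0 (γ q)).1, (Φ 0 (γ q)).2.1) = _
    rw [hΦ0 _ hq]
  have hΨd : ∀ q ∈ W, HasDerivAt (fun t => Ψ (t, q)) (1, (v.1 (γ q)).1, (v.1 (γ q)).2.1) 0 :=
    fun q hq => (hasDerivAt_id 0).prodMk ((hΦd0 q hq).fst.prodMk (hΦd0 q hq).snd.fst)
  set q₀ : ℝ × ℝ := (p.1, p.2.1) with hq₀
  have hq₀W : q₀ ∈ W := by
    change (p.1, p.2.1, u q₀) ∈ N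
    rw [hup]
    exact hpN
  have hz₀D : ((0, q₀) : PointSpace) ∈ D := ⟨h0δ, hq₀W⟩
  have hΨf : HasFDerivAt Ψ (fderiv ℝ Ψ (0, q₀)) (0, q₀) :=
    ((hΨs.contDiffAt (hDo.mem_nhds hz₀D)).differentiableAt (by simp)).hasFDerivAt
  -- At time zero `Ψ` is the identity in `q`, so its derivative is a shear: it fixes the space
  -- directions and sends the time direction to `(1, ξ, η)`.
  have hinj : Function.Injective (fderiv ℝ Ψ (0, q₀)) := by
    have h1 : fderiv ℝ Ψ (0, q₀) (1, 0) = (1, (v.1 (γ q₀)).1, (v.1 (γ q₀)).2.1) := by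
      have hc : HasDerivAt (fun t : ℝ => ((t, q₀) : PointSpace)) (1, 0) 0 :=
        (hasDerivAt_id 0).prodMk (hasDerivAt_const _ _)
      exact (HasFDerivAt.comp_hasDerivAt (f := fun t : ℝ => ((t, q₀) : PointSpace)) (0 : ℝ)
        hΨf hc).unique (hΨd q₀ hq₀W)
    have h2 : ∀ e, fderiv ℝ Ψ (0, q₀) (0, e) = (0, e) := by
      have hc : HasFDerivAt (fun q : ℝ × ℝ => ((0, q) : PointSpace))
          (ContinuousLinearMap.inr ℝ ℝ (ℝ × ℝ)) q₀ :=
        (hasFDerivAt_const _ _).prodMk (hasFDerivAt_id _)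
      have h3 := (hΨf.comp q₀ hc).unique (hc.congr_of_eventuallyEq
        (Filter.eventuallyEq_of_mem (hW.mem_nhds hq₀W) hΨ0))
      exact fun e => DFunLike.congr_fun h3 e
    refine (injective_iff_map_eq_zero _).2 fun z hz => ?_
    have h4 : z = z.1 • ((1, 0) : PointSpace) + (0, z.2) := by ext <;> simp
    rw [h4, map_add, map_smul, h1, h2] at hz
    have h5 : z.1 = 0 := by simpa using congrArg Prod.fst hz
    rw [h5] at hz
    ext
    · exact h5
    · simpa using congrArg (fun y => y.2.1) hz
    · simpa using congrArg (fun y => y.2.2) hz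
  obtain ⟨O, T, κ, hO, hOD, hzO, hT, hκs, hκ, hκ'⟩ :=
    exists_smooth_localInverse hDo hΨs hz₀D hinj
  have hTz : T ∈ 𝓝 ((0, q₀) : PointSpace) := hT.mem_nhds (by
    simpa [hΨ0 q₀ hq₀W] using (hκ' _ hzO).1)
  obtain ⟨I, hI, V', hV', hIV⟩ := mem_nhds_prod_iff.1 hTz
  obtain ⟨ε, hε, hεI⟩ := Metric.mem_nhds_iff.1 hI
  obtain ⟨V, hVV', hV, hq₀V⟩ := mem_nhds_iff.1 hV'
  have hVT : ∀ t ∈ Ioo (-ε) ε, ∀ q ∈ V, ((t, q) : PointSpace) ∈ T := fun t ht q hq =>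
    hIV (mk_mem_prod (hεI (by rwa [Real.ball_eq_Ioo, zero_sub, zero_add])) (hVV' hq))
  have h0ε : (0 : ℝ) ∈ Ioo (-ε) ε := ⟨by linarith, hε⟩
  set w : PointSpace → ℝ := fun z => (H (κ z)).2.2 with hw
  have hws : ContDiffOn ℝ ∞ w T :=
    (hHs.comp hκs fun z hz => hOD (hκ z hz).1).snd.snd
  have hκ1 : ∀ z ∈ T, (κ z).1 = z.1 := fun z hz => by
    change (Ψ (κ z)).1 = z.1
    rw [(hκ z hz).2]
  have hHκ : ∀ z ∈ T, Φ z.1 (γ (κ z).2) = (z.2.1, z.2.2, w z) := fun z hz => by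
    have h1 : Φ z.1 (γ (κ z).2) = H (κ z) := by simp only [hH, hκ1 z hz]
    have h2 := (hκ z hz).2
    rw [h1]
    ext
    · exact congrArg (fun y => y.2.1) h2
    · exact congrArg (fun y => y.2.2) h2
    · rfl
  have hκ0 : ∀ q ∈ V, κ (0, q) = (0, q) ∧ q ∈ W := fun q hq => by
    have hz := hVT 0 h0ε q hq
    have hqW : (κ (0, q)).2 ∈ W := (hOD (hκ _ hz).1).2
    have h1 : κ (0, q) = (0, (κ (0, q)).2) := Prod.ext (hκ1 _ hz) rfl
    have h2 := (hκ _ hz).2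
    rw [h1, hΨ0 _ hqW] at h2
    rw [h2] at h1
    exact ⟨h1, by rw [h1] at hqW; exact hqW⟩
  refine ⟨ε, V, T, w, hε, hV, hq₀V, hT, hws, hVT, fun t ht => ?_, fun q hq => ?_, fun q hq => ?_⟩
  · have htδ : t ∈ Ioo (-δ) δ := by
      have hz := hVT t ht q₀ hq₀V
      have h : (κ (t, q₀)).1 ∈ Ioo (-δ) δ := (hOD (hκ _ hz).1).1
      rwa [hκ1 _ hz] at h
    refine hpres t htδ W V u _ (hu.mono hW (subset_univ W)) (fun q hq => hq) hV ?_ fun q hq => ?_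
    · exact hws.comp (f := fun q : ℝ × ℝ => ((t, q) : PointSpace)) (by fun_prop)
        fun q hq => hVT t ht q hq
    · have hz := hVT t ht q hq
      exact ⟨(κ (t, q)).2, (hOD (hκ _ hz).1).2, hHκ _ hz⟩
  · obtain ⟨h1, h2⟩ := hκ0 q hq
    refine ⟨hNU _ h2, ?_⟩
    simp only [hw, h1]
    change (Φ 0 (γ q)).2.2 = u q
    rw [hΦ0 _ h2]
  · obtain ⟨h1, h2⟩ := hκ0 q hq
    have hz := hVT 0 h0ε q hq
    have hwd : HasFDerivAt w (fderiv ℝ w (0, q)) (Ψ (0, q)) := by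
      rw [hΨ0 q h2]
      exact ((hws.contDiffAt (hT.mem_nhds hz)).differentiableAt (by simp)).hasFDerivAt
    have hO0 : ((0, q) : PointSpace) ∈ O := by simpa [h1] using (hκ _ hz).1
    have hc : Continuous fun t : ℝ => ((t, q) : PointSpace) := by fun_prop
    have he : (w ∘ fun t => Ψ (t, q)) =ᶠ[𝓝 0] fun t => (Φ t (γ q)).2.2 := by
      filter_upwards [hc.continuousAt.preimage_mem_nhds (hO.mem_nhds hO0)] with t ht
      change (H (κ (Ψ (t, q)))).2.2 = _
      rw [(hκ' _ ht).2]
    have hs : HasDerivAt (fun t => (Φ t (γ q)).2.2) (v.1 (γ q)).2.2 0 := (hΦd0 q h2).snd.snd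
    exact (HasFDerivAt.comp_hasDerivAt (f := fun t => Ψ (t, q)) (0 : ℝ) hwd (hΨd q h2)).unique
      (HasDerivAt.congr_of_eventuallyEq hs he)

/-! ### Differentiating the equation along a family of solutions -/

theorem HasPartialsOn.slice {T : Set PointSpace} (hT : IsOpen T) {w : PointSpace → ℝ}
    (hw : ContDiffOn ℝ ∞ w T) {V : Set (ℝ × ℝ)} {t : ℝ}
    (hV : ∀ q ∈ V, ((t, q) : PointSpace) ∈ T) :
    HasPartialsOn V (fun q => w (t, q)) (fun q => dirDeriv (0, 1, 0) w (t, q))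
      (fun q => dirDeriv (0, 0, 1) w (t, q)) := fun q hq => by
  have hd := ((hw.contDiffAt (hT.mem_nhds (hV q hq))).differentiableAt (by simp)).hasFDerivAt
  have hc : HasFDerivAt (fun q : ℝ × ℝ => ((t, q) : PointSpace))
    (ContinuousLinearMap.inr ℝ ℝ (ℝ × ℝ)) q := (hasFDerivAt_const _ _).prodMk (hasFDerivAt_id _)
  exact (HasFDerivAt.comp (f := fun q : ℝ × ℝ => ((t, q) : PointSpace)) q hd hc).congr_fderiv
    (by ext <;> simp [dirDeriv])

theorem third_partials_slice {T : Set PointSpace} (hT : IsOpen T) {w : PointSpace → ℝ}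
    (hw : ContDiffOn ℝ ∞ w T) {V : Set (ℝ × ℝ)} (hVo : IsOpen V) {t : ℝ}
    (hV : ∀ q ∈ V, ((t, q) : PointSpace) ∈ T) :
    EqOn (partialX (partialX (partialX fun q => w (t, q))))
      (fun q => dirDeriv (0, 1, 0) (dirDeriv (0, 1, 0) (dirDeriv (0, 1, 0) w)) (t, q)) V ∧
    EqOn (partialY (partialX (partialX fun q => w (t, q))))
      (fun q => dirDeriv (0, 0, 1) (dirDeriv (0, 1, 0) (dirDeriv (0, 1, 0) w)) (t, q)) V ∧
    EqOn (partialY (partialY (partialX fun q => w (t, q))))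
      (fun q => dirDeriv (0, 0, 1) (dirDeriv (0, 0, 1) (dirDeriv (0, 1, 0) w)) (t, q)) V ∧
    EqOn (partialY (partialY (partialY fun q => w (t, q))))
      (fun q => dirDeriv (0, 0, 1) (dirDeriv (0, 0, 1) (dirDeriv (0, 0, 1) w)) (t, q)) V := by
  have hx := hw.dirDeriv hT (0, 1, 0)
  have hy := hw.dirDeriv hT (0, 0, 1)
  exact HasPartialsOn.third_partials hVo (.slice hT hw hV) (.slice hT hx hV) (.slice hT hy hV)
    (.slice hT (hx.dirDeriv hT _) hV) (.slice hT (hx.dirDeriv hT _) hV)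
    (.slice hT (hy.dirDeriv hT _) hV)

theorem third_partials_congr {V : Set (ℝ × ℝ)} (hV : IsOpen V) {F G : ℝ × ℝ → ℝ}
    (h : EqOn F G V) :
    EqOn (partialX (partialX (partialX F))) (partialX (partialX (partialX G))) V ∧
    EqOn (partialY (partialX (partialX F))) (partialY (partialX (partialX G))) V ∧
    EqOn (partialY (partialY (partialX F))) (partialY (partialY (partialX G))) V ∧
    EqOn (partialY (partialY (partialY F))) (partialY (partialY (partialY G))) V := by
  have hx := dirDeriv_congr hV h (1, 0)
  have hxx := dirDeriv_congr hV hx (1, 0)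
  exact ⟨dirDeriv_congr hV hxx _, dirDeriv_congr hV hxx _,
    dirDeriv_congr hV (dirDeriv_congr hV hx (0, 1)) _,
    dirDeriv_congr hV (dirDeriv_congr hV (dirDeriv_congr hV h (0, 1)) (0, 1)) _⟩

theorem dirDeriv_comm_three {E : Type*} [NormedAddCommGroup E] [NormedSpace ℝ E] {U : Set E}
    (hU : IsOpen U) {g : E → ℝ} (hg : ContDiffOn ℝ ∞ g U) (e a b c : E) :
    EqOn (dirDeriv e (dirDeriv a (dirDeriv b (dirDeriv c g))))
      (dirDeriv a (dirDeriv b (dirDeriv c (dirDeriv e g)))) U :=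
  (dirDeriv_comm hU ((hg.dirDeriv hU c).dirDeriv hU b) e a).trans <|
    dirDeriv_congr hU ((dirDeriv_comm hU (hg.dirDeriv hU c) e b).trans <|
      dirDeriv_congr hU (dirDeriv_comm hU hg e c) b) a

/-- The characteristic of the vector field `v` on the graph of `u`. -/
noncomputable def characteristic (v : PointSpace → PointSpace) (u : ℝ × ℝ → ℝ) : ℝ × ℝ → ℝ :=
  fun q => (v (q.1, q.2, u q)).2.2 - (v (q.1, q.2, u q)).1 * partialX u q -
    (v (q.1, q.2, u q)).2.1 * partialY u q

theorem linearized_equation {U : Opens PointSpace} {v : smoothVectorFields U}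
    (hv : IsPointSymmetry U v) {p : PointSpace} (hp : p ∈ U) {u : ℝ × ℝ → ℝ}
    (hu : IsSolutionOn univ u) (hup : u (p.1, p.2.1) = p.2.2) :
    partialX (partialX (partialX u)) (p.1, p.2.1) *
        partialY (partialY (partialY (characteristic v.1 u))) (p.1, p.2.1) +
      partialY (partialY (partialY u)) (p.1, p.2.1) *
        partialX (partialX (partialX (characteristic v.1 u))) (p.1, p.2.1) -
      partialY (partialX (partialX u)) (p.1, p.2.1) *
        partialY (partialY (partialX (characteristic v.1 u))) (p.1, p.2.1) -
      partialY (partialY (partialX u)) (p.1, p.2.1) *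
        partialY (partialX (partialX (characteristic v.1 u))) (p.1, p.2.1) = 0 := by
  obtain ⟨ε, V, T, w, hε, hV, hqV, hT, hw, hVT, hsol, hw0, hwd⟩ :=
    exists_transported_solutions hv hp hu hup
  set q₀ : ℝ × ℝ := (p.1, p.2.1)
  have h0ε : (0 : ℝ) ∈ Ioo (-ε) ε := ⟨by linarith, hε⟩
  have hV0 := hVT 0 h0ε
  have hz := hV0 q₀ hqV
  have hslice0 : EqOn (fun q => w (0, q)) u V := fun q hq => (hw0 q hq).2
  -- The derivative of `w` along `(1, ξ, η)` is `ζ`; subtracting the space part `ξ u_x + η u_y`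
  -- leaves the time derivative.
  have hchar : EqOn (fun q => dirDeriv (1, 0, 0) w (0, q)) (characteristic v.1 u) V := by
    intro q hq
    have h1 := hwd q hq
    have h2 := HasPartialsOn.slice hT hw hV0
    have hx : partialX u q = dirDeriv (0, 1, 0) w (0, q) :=
      (dirDeriv_congr hV hslice0 (1, 0) hq).symm.trans (h2.partialX_eqOn hq)
    have hy : partialY u q = dirDeriv (0, 0, 1) w (0, q) :=
      (dirDeriv_congr hV hslice0 (0, 1) hq).symm.trans (h2.partialY_eqOn hq)
    simp only [characteristic, hx, hy, dirDeriv, ← h1]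
    set ξ := (v.1 (q.1, q.2, u q)).1
    set η := (v.1 (q.1, q.2, u q)).2.1
    have h3 : ((1, ξ, η) : PointSpace) = (1, 0, 0) + ξ • (0, 1, 0) + η • (0, 0, 1) := by simp
    rw [h3, map_add, map_add, map_smul, map_smul]
    simp only [smul_eq_mul]
    ring
  set X : PointSpace := (0, 1, 0)
  set Y : PointSpace := (0, 0, 1)
  have hpde : ∀ t ∈ Ioo (-ε) ε,
      dirDeriv X (dirDeriv X (dirDeriv X w)) (t, q₀) *
          dirDeriv Y (dirDeriv Y (dirDeriv Y w)) (t, q₀) -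
        dirDeriv Y (dirDeriv X (dirDeriv X w)) (t, q₀) *
          dirDeriv Y (dirDeriv Y (dirDeriv X w)) (t, q₀) - 1 = 0 := by
    intro t ht
    obtain ⟨h1, h2, h3, h4⟩ := third_partials_slice hT hw hV (hVT t ht)
    have h := (hsol t ht).2.2 q₀ hqV
    rwa [h1 hqV, h2 hqV, h3 hqV, h4 hqV] at h
  -- The time derivative commutes past the three space derivatives and lands on `w`, where it
  -- becomes the characteristic.
  have hthird : ∀ a b c : PointSpace, HasDerivAt
      (fun t => dirDeriv a (dirDeriv b (dirDeriv c w)) (t, q₀))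
      (dirDeriv a (dirDeriv b (dirDeriv c (dirDeriv (1, 0, 0) w))) (0, q₀)) 0 := by
    intro a b c
    rw [← dirDeriv_comm_three hT hw _ a b c hz]
    have hs := ((hw.dirDeriv hT c).dirDeriv hT b).dirDeriv hT a
    have hd := ((hs.contDiffAt (hT.mem_nhds hz)).differentiableAt (by simp)).hasFDerivAt
    have hc : HasDerivAt (fun t : ℝ => ((t, q₀) : PointSpace)) (1, 0, 0) 0 :=
      (hasDerivAt_id 0).prodMk (hasDerivAt_const _ _)
    exact HasFDerivAt.comp_hasDerivAt (f := fun t : ℝ => ((t, q₀) : PointSpace)) (0 : ℝ) hd hc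
  have hder := ((((hthird X X X).mul (hthird Y Y Y)).sub
    ((hthird Y X X).mul (hthird Y Y X))).sub_const 1).unique
    (HasDerivAt.congr_of_eventuallyEq (hasDerivAt_const (0 : ℝ) (0 : ℝ))
      (Filter.eventuallyEq_of_mem (Ioo_mem_nhds h0ε.1 h0ε.2) hpde))
  obtain ⟨a1, a2, a3, a4⟩ := third_partials_slice hT hw hV hV0
  obtain ⟨b1, b2, b3, b4⟩ := third_partials_congr hV hslice0
  obtain ⟨c1, c2, c3, c4⟩ := third_partials_slice hT (hw.dirDeriv hT (1, 0, 0)) hV hV0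
  obtain ⟨d1, d2, d3, d4⟩ := third_partials_congr hV hchar
  rw [← b1 hqV, ← b2 hqV, ← b3 hqV, ← b4 hqV, ← d1 hqV, ← d2 hqV, ← d3 hqV, ← d4 hqV, a1 hqV,
    a2 hqV, a3 hqV, a4 hqV, c1 hqV, c2 hqV, c3 hqV, c4 hqV]
  simp only at hder ⊢
  linear_combination hder

/-! ### The determining equations -/

/-- The partial derivative `∂g/∂x` of a function `g` of `(x, y, f)`. -/
noncomputable def derivX (g : PointSpace → ℝ) : PointSpace → ℝ := dirDeriv (1, 0, 0) g

/-- The partial derivative `∂g/∂y` of a function `g` of `(x, y, f)`. -/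
noncomputable def derivY (g : PointSpace → ℝ) : PointSpace → ℝ := dirDeriv (0, 1, 0) g

/-- The partial derivative `∂g/∂f` of a function `g` of `(x, y, f)`. -/
noncomputable def derivF (g : PointSpace → ℝ) : PointSpace → ℝ := dirDeriv (0, 0, 1) g

section TotalDerivatives

variable (g : PointSpace → ℝ) (P : PointSpace) (p q r s t a b c d : ℝ)

/-- The total derivative `D_x g` at a jet. -/
noncomputable def totalX : ℝ := derivX g P + derivF g P * p

/-- The total derivative `D_y g` at a jet. -/
noncomputable def totalY : ℝ := derivY g P + derivF g P * q

/-- The total derivative `D_x D_x g` at a jet. -/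
noncomputable def totalXX : ℝ :=
  derivX (derivX g) P + 2 * derivX (derivF g) P * p + derivF (derivF g) P * p ^ 2 + derivF g P * r

/-- The total derivative `D_x D_y g` at a jet. -/
noncomputable def totalXY : ℝ :=
  derivY (derivX g) P + derivX (derivF g) P * q + derivY (derivF g) P * p +
    derivF (derivF g) P * (p * q) + derivF g P * s

/-- The total derivative `D_y D_y g` at a jet. -/
noncomputable def totalYY : ℝ :=
  derivY (derivY g) P + 2 * derivY (derivF g) P * q + derivF (derivF g) P * q ^ 2 + derivF g P * t

/-- The total derivative `D_x D_x D_x g` at a jet. -/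
noncomputable def totalXXX : ℝ :=
  derivX (derivX (derivX g)) P + 3 * derivX (derivX (derivF g)) P * p +
    3 * derivX (derivF (derivF g)) P * p ^ 2 + derivF (derivF (derivF g)) P * p ^ 3 +
    3 * derivX (derivF g) P * r + 3 * derivF (derivF g) P * (p * r) + derivF g P * a

/-- The total derivative `D_x D_x D_y g` at a jet. -/
noncomputable def totalXXY : ℝ :=
  derivY (derivX (derivX g)) P + 2 * derivY (derivX (derivF g)) P * p +
    derivX (derivX (derivF g)) P * q + derivY (derivF (derivF g)) P * p ^ 2 +
    2 * derivX (derivF (derivF g)) P * (p * q) + derivF (derivF (derivF g)) P * (p ^ 2 * q) +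
    derivY (derivF g) P * r + 2 * derivX (derivF g) P * s +
    derivF (derivF g) P * (2 * p * s + q * r) + derivF g P * b

/-- The total derivative `D_x D_y D_y g` at a jet. -/
noncomputable def totalXYY : ℝ :=
  derivY (derivY (derivX g)) P + 2 * derivY (derivX (derivF g)) P * q +
    derivY (derivY (derivF g)) P * p + derivX (derivF (derivF g)) P * q ^ 2 +
    2 * derivY (derivF (derivF g)) P * (p * q) + derivF (derivF (derivF g)) P * (p * q ^ 2) +
    derivX (derivF g) P * t + 2 * derivY (derivF g) P * s +
    derivF (derivF g) P * (2 * q * s + p * t) + derivF g P * c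

/-- The total derivative `D_y D_y D_y g` at a jet. -/
noncomputable def totalYYY : ℝ :=
  derivY (derivY (derivY g)) P + 3 * derivY (derivY (derivF g)) P * q +
    3 * derivY (derivF (derivF g)) P * q ^ 2 + derivF (derivF (derivF g)) P * q ^ 3 +
    3 * derivY (derivF g) P * t + 3 * derivF (derivF g) P * (q * t) + derivF g P * d

end TotalDerivatives

/-! ### Evaluating the linearized equation on cubic solutions -/

/-- The restriction of `g` to the graph of `u`. -/
noncomputable def onGraph (u : ℝ × ℝ → ℝ) (g : PointSpace → ℝ) : ℝ × ℝ → ℝ :=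
  fun z => g (z.1, z.2, u z)

theorem HasPartialsOn.onGraph {U : Set PointSpace} (hU : IsOpen U) {W : Set (ℝ × ℝ)}
    {u ux uy : ℝ × ℝ → ℝ} (hu : HasPartialsOn W u ux uy)
    (hW : ∀ z ∈ W, ((z.1, z.2, u z) : PointSpace) ∈ U) {g : PointSpace → ℝ}
    (hg : ContDiffOn ℝ ∞ g U) :
    HasPartialsOn W (onGraph u g) (onGraph u (derivX g) + onGraph u (derivF g) * ux)
      (onGraph u (derivY g) + onGraph u (derivF g) * uy) := fun z hz => by
  have hd := ((hg.contDiffAt (hU.mem_nhds (hW z hz))).differentiableAt (by simp)).hasFDerivAt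
  have hc : HasFDerivAt (fun z : ℝ × ℝ => ((z.1, z.2, u z) : PointSpace)) _ z :=
    hasFDerivAt_fst.prodMk (hasFDerivAt_snd.prodMk (hu z hz))
  refine (HasFDerivAt.comp (f := fun z : ℝ × ℝ => ((z.1, z.2, u z) : PointSpace)) z hd
    hc).congr_fderiv ?_
  have h3 : ∀ e : ℝ × ℝ × ℝ, e = e.1 • (1, 0, 0) + e.2.1 • (0, 1, 0) + e.2.2 • (0, 0, 1) := by
    simp
  ext
  · simp only [ContinuousLinearMap.comp_apply, ContinuousLinearMap.inl_apply]
    rw [h3 ((ContinuousLinearMap.prod _ _) _), map_add, map_add, map_smul, map_smul, map_smul]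
    simp [_root_.onGraph, derivX, derivF, dirDeriv, mul_comm]
  · simp only [ContinuousLinearMap.comp_apply, ContinuousLinearMap.inr_apply]
    rw [h3 ((ContinuousLinearMap.prod _ _) _), map_add, map_add, map_smul, map_smul, map_smul]
    simp [_root_.onGraph, derivY, derivF, dirDeriv, mul_comm]

/-- This is the linearized equation at the cubic solution with the prescribed jet at `P`. The four
brackets are the third derivatives of the characteristic by the Leibniz rule; fourth derivatives of
`u` do not occur, since those of a cubic vanish. -/
theorem determining_equation {U : Opens PointSpace} {v : smoothVectorFields U}
    (hv : IsPointSymmetry U v) {ξ η ζ : PointSpace → ℝ} (hξ : ξ = fun p => (v.1 p).1)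
    (hη : η = fun p => (v.1 p).2.1) (hζ : ζ = fun p => (v.1 p).2.2)
    {P : PointSpace} (hP : P ∈ U) (p q r s t : ℝ) {a b c d : ℝ} (h : a * d - b * c = 1) :
    a * (totalYYY ζ P q t d - (totalYYY ξ P q t d * p + 3 * totalYY ξ P q t * s +
        3 * totalY ξ P q * c) - (totalYYY η P q t d * q + 3 * totalYY η P q t * t +
        3 * totalY η P q * d)) +
      d * (totalXXX ζ P p r a - (totalXXX ξ P p r a * p + 3 * totalXX ξ P p r * r +
        3 * totalX ξ P p * a) - (totalXXX η P p r a * q + 3 * totalXX η P p r * s +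
        3 * totalX η P p * b)) -
      b * (totalXYY ζ P p q s t c - (totalXYY ξ P p q s t c * p + totalYY ξ P q t * r +
        2 * totalXY ξ P p q s * s + 2 * totalY ξ P q * b + totalX ξ P p * c) -
        (totalXYY η P p q s t c * q + totalYY η P q t * s + 2 * totalXY η P p q s * t +
        2 * totalY η P q * c + totalX η P p * d)) -
      c * (totalXXY ζ P p q r s b - (totalXXY ξ P p q r s b * p + totalXX ξ P p r * s +
        2 * totalXY ξ P p q s * r + 2 * totalX ξ P p * b + totalY ξ P q * a) -
        (totalXXY η P p q r s b * q + totalXX η P p r * t + 2 * totalXY η P p q s * s +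
        2 * totalX η P p * c + totalY η P q * b)) = 0 := by
  have hsξ : ContDiffOn ℝ ∞ ξ U := hξ ▸ v.2.1.fst
  have hsη : ContDiffOn ℝ ∞ η U := hη ▸ v.2.1.snd.fst
  have hsζ : ContDiffOn ℝ ∞ ζ U := hζ ▸ v.2.1.snd.snd
  have hsX : ∀ g, ContDiffOn ℝ ∞ g U → ContDiffOn ℝ ∞ (derivX g) U := fun g hg =>
    hg.dirDeriv U.2 _
  have hsY : ∀ g, ContDiffOn ℝ ∞ g U → ContDiffOn ℝ ∞ (derivY g) U := fun g hg =>
    hg.dirDeriv U.2 _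
  have hsF : ∀ g, ContDiffOn ℝ ∞ g U → ContDiffOn ℝ ∞ (derivF g) U := fun g hg =>
    hg.dirDeriv U.2 _
  have cFX : ∀ g, ContDiffOn ℝ ∞ g U → EqOn (derivF (derivX g)) (derivX (derivF g)) U :=
    fun g hg => dirDeriv_comm U.2 hg _ _
  have cFY : ∀ g, ContDiffOn ℝ ∞ g U → EqOn (derivF (derivY g)) (derivY (derivF g)) U :=
    fun g hg => dirDeriv_comm U.2 hg _ _
  set u := cubicPoly P.1 P.2.1 P.2.2 p q r s t a b c d with hu
  set z₀ : ℝ × ℝ := (P.1, P.2.1) with hz₀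
  have huP : u z₀ = P.2.2 := cubicPoly_apply_self ..
  have hus : ContDiff ℝ ∞ u := cubicPoly_contDiff ..
  set W : Set (ℝ × ℝ) := (fun z : ℝ × ℝ => ((z.1, z.2, u z) : PointSpace)) ⁻¹' U with hWdef
  have hWo : IsOpen W := U.2.preimage (by fun_prop)
  have hz₀W : z₀ ∈ W := by
    change (P.1, P.2.1, u z₀) ∈ U
    rwa [huP]
  have hC := fun f p q r s t a b c d => HasPartialsOn.cubicPoly W P.1 P.2.1 f p q r s t a b c d
  have hG : ∀ g, ContDiffOn ℝ ∞ g U → HasPartialsOn W (onGraph u g)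
      (onGraph u (derivX g) + onGraph u (derivF g) * cubicPoly P.1 P.2.1 p r s a b c 0 0 0 0)
      (onGraph u (derivY g) + onGraph u (derivF g) * cubicPoly P.1 P.2.1 q s t b c d 0 0 0 0) :=
    fun g hg => HasPartialsOn.onGraph U.2 (hC P.2.2 p q r s t a b c d) (fun z hz => hz) hg
  have hux : EqOn (partialX u) (cubicPoly P.1 P.2.1 p r s a b c 0 0 0 0) W :=
    (hC _ _ _ _ _ _ _ _ _ _).partialX_eqOn
  have huy : EqOn (partialY u) (cubicPoly P.1 P.2.1 q s t b c d 0 0 0 0) W :=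
    (hC _ _ _ _ _ _ _ _ _ _).partialY_eqOn
  have hQ : EqOn (characteristic v.1 u)
      (onGraph u ζ - onGraph u ξ * cubicPoly P.1 P.2.1 p r s a b c 0 0 0 0 -
        onGraph u η * cubicPoly P.1 P.2.1 q s t b c d 0 0 0 0) W := fun z hz => by
    simp [characteristic, onGraph, hξ, hη, hζ, hux hz, huy hz]
  obtain ⟨a1, a2, a3, a4⟩ := HasPartialsOn.third_partials hWo (hC P.2.2 p q r s t a b c d)
    (hC _ _ _ _ _ _ _ _ _ _) (hC _ _ _ _ _ _ _ _ _ _) (hC _ _ _ _ _ _ _ _ _ _)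
    (hC _ _ _ _ _ _ _ _ _ _) (hC _ _ _ _ _ _ _ _ _ _)
  obtain ⟨b1, b2, b3, b4⟩ := third_partials_congr hWo hQ
  have lin := linearized_equation hv hP
    (isSolutionOn_cubicPoly isOpen_univ P.1 P.2.1 P.2.2 p q r s t h) huP
  rw [← hu, ← hz₀, a1 hz₀W, a2 hz₀W, a3 hz₀W, a4 hz₀W, b1 hz₀W, b2 hz₀W, b3 hz₀W, b4 hz₀W] at lin
  simp only [cubicPoly_const] at lin
  have hO : ∀ g, onGraph u g z₀ = g P := fun g => by
    change g (P.1, P.2.1, u z₀) = _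
    rw [huP]
  have hc0 : ∀ f p q r s t a b c d, cubicPoly P.1 P.2.1 f p q r s t a b c d z₀ = f :=
    fun _ _ _ _ _ _ _ _ _ _ => cubicPoly_apply_self ..
  have iXFX : ∀ g, ContDiffOn ℝ ∞ g U →
      derivX (derivF (derivX g)) P = derivX (derivX (derivF g)) P :=
    fun g hg => dirDeriv_congr U.2 (cFX g hg) _ hP
  have iYFX : ∀ g, ContDiffOn ℝ ∞ g U →
      derivY (derivF (derivX g)) P = derivY (derivX (derivF g)) P :=
    fun g hg => dirDeriv_congr U.2 (cFX g hg) _ hP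
  have iYFY : ∀ g, ContDiffOn ℝ ∞ g U →
      derivY (derivF (derivY g)) P = derivY (derivY (derivF g)) P :=
    fun g hg => dirDeriv_congr U.2 (cFY g hg) _ hP
  have iFFX : ∀ g, ContDiffOn ℝ ∞ g U →
      derivF (derivF (derivX g)) P = derivX (derivF (derivF g)) P :=
    fun g hg => (dirDeriv_congr U.2 (cFX g hg) _ hP).trans (cFX _ (hsF g hg) hP)
  have iFFY : ∀ g, ContDiffOn ℝ ∞ g U →
      derivF (derivF (derivY g)) P = derivY (derivF (derivF g)) P :=
    fun g hg => (dirDeriv_congr U.2 (cFY g hg) _ hP).trans (cFY _ (hsF g hg) hP)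
  have oFX : ∀ g, ContDiffOn ℝ ∞ g U → derivF (derivX g) P = derivX (derivF g) P :=
    fun g hg => cFX g hg hP
  have oFY : ∀ g, ContDiffOn ℝ ∞ g U → derivF (derivY g) P = derivY (derivF g) P :=
    fun g hg => cFY g hg hP
  obtain ⟨Q, hQdef⟩ : ∃ Q, Q = onGraph u ζ - onGraph u ξ * cubicPoly P.1 P.2.1 p r s a b c 0 0 0 0 -
    onGraph u η * cubicPoly P.1 P.2.1 q s t b c d 0 0 0 0 := ⟨_, rfl⟩
  have key : ∃ Qxxx Qxxy Qxyy Qyyy : ℝ × ℝ → ℝ,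
      (EqOn (partialX (partialX (partialX Q))) Qxxx W ∧
        EqOn (partialY (partialX (partialX Q))) Qxxy W ∧
        EqOn (partialY (partialY (partialX Q))) Qxyy W ∧
        EqOn (partialY (partialY (partialY Q))) Qyyy W) ∧
      Qxxx z₀ = totalXXX ζ P p r a - (totalXXX ξ P p r a * p + 3 * totalXX ξ P p r * r +
        3 * totalX ξ P p * a) - (totalXXX η P p r a * q + 3 * totalXX η P p r * s +
        3 * totalX η P p * b) ∧
      Qxxy z₀ = totalXXY ζ P p q r s b - (totalXXY ξ P p q r s b * p + totalXX ξ P p r * s +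
        2 * totalXY ξ P p q s * r + 2 * totalX ξ P p * b + totalY ξ P q * a) -
        (totalXXY η P p q r s b * q + totalXX η P p r * t + 2 * totalXY η P p q s * s +
        2 * totalX η P p * c + totalY η P q * b) ∧
      Qxyy z₀ = totalXYY ζ P p q s t c - (totalXYY ξ P p q s t c * p + totalYY ξ P q t * r +
        2 * totalXY ξ P p q s * s + 2 * totalY ξ P q * b + totalX ξ P p * c) -
        (totalXYY η P p q s t c * q + totalYY η P q t * s + 2 * totalXY η P p q s * t +
        2 * totalY η P q * c + totalX η P p * d) ∧
      Qyyy z₀ = totalYYY ζ P q t d - (totalYYY ξ P q t d * p + 3 * totalYY ξ P q t * s +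
        3 * totalY ξ P q * c) - (totalYYY η P q t d * q + 3 * totalYY η P q t * t +
        3 * totalY η P q * d) := by
    -- The four witnesses are left open: the structural rules for sums and products in
    -- `HasPartialsOn` fill them in by unification. The commutation rules then bring mixed
    -- derivatives into the normal form with the `f`-derivative innermost, so that `ring` can
    -- compare.
    iterate 4 apply Exists.intro
    apply And.intro
    · rw [hQdef]
      apply HasPartialsOn.third_partials hWo
      case h | hx | hy | hxx | hxy | hyy =>
        repeat' first
          | exact hG _ (by repeat' first | assumption | apply hsX | apply hsY | apply hsF)
          | exact hC _ _ _ _ _ _ _ _ _ _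
          | apply HasPartialsOn.sub
          | apply HasPartialsOn.add
          | apply HasPartialsOn.mul
    simp only [Pi.add_apply, Pi.sub_apply, Pi.mul_apply, hO, hc0, iXFX, iYFX, iYFY, iFFX, iFFY,
      oFX, oFY, hsX, hsY, hsF, hsξ, hsη, hsζ, totalX, totalY, totalXX, totalXY, totalYY, totalXXX,
      totalXXY, totalXYY, totalYYY]
    refine ⟨?_, ?_, ?_, ?_⟩ <;> ring
  obtain ⟨Qxxx, Qxxy, Qxyy, Qyyy, ⟨e1, e2, e3, e4⟩, f1, f2, f3, f4⟩ := key
  rw [← hQdef, e1 hz₀W, e2 hz₀W, e3 hz₀W, e4 hz₀W, f1, f2, f3, f4] at lin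
  exact lin

theorem derivF_eq_zero_of_isPointSymmetry {U : Opens PointSpace} {v : smoothVectorFields U}
    (hv : IsPointSymmetry U v) {P : PointSpace} (hP : P ∈ U) :
    derivF (fun p => (v.1 p).1) P = 0 ∧ derivF (fun p => (v.1 p).2.1) P = 0 := by
  have E := fun p q r s t a b c d h =>
    determining_equation hv rfl rfl rfl hP p q r s t (a := a) (b := b) (c := c) (d := d) h
  simp only [totalX, totalY, totalXX, totalXY, totalYY, totalXXX, totalXXY, totalXYY,
    totalYYY] at E
  -- With `a = d = 1`, `b = c = 0` and `p = q = s = 0`, the coefficient of `r²` is `-3 ξ_f` and that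
  -- of `t²` is `-3 η_f`; second differences extract them.
  have e0 := E 0 0 0 0 0 1 0 0 1 (by norm_num)
  have e1 := E 0 0 1 0 0 1 0 0 1 (by norm_num)
  have e2 := E 0 0 (-1) 0 0 1 0 0 1 (by norm_num)
  have e3 := E 0 0 0 0 1 1 0 0 1 (by norm_num)
  have e4 := E 0 0 0 0 (-1) 1 0 0 1 (by norm_num)
  constructor
  · linear_combination (-1 / 6) * (e1 + e2 - 2 * e0)
  · linear_combination (-1 / 6) * (e3 + e4 - 2 * e0)

theorem dirDeriv_dirDeriv_eq_zero {U : Opens PointSpace} {g : PointSpace → ℝ}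
    (hg : ContDiffOn ℝ ∞ g U) {e : PointSpace} (h : ∀ P ∈ U, dirDeriv e g P = 0)
    (e' : PointSpace) : ∀ P ∈ U, dirDeriv e (dirDeriv e' g) P = 0 := fun P hP => by
  rw [dirDeriv_comm U.2 hg _ _ hP]
  exact dirDeriv_zero_of_eqOn U.2 h _ hP

theorem derivF_derivF_eq_zero_of_isPointSymmetry {U : Opens PointSpace}
    {v : smoothVectorFields U} (hv : IsPointSymmetry U v) {P : PointSpace} (hP : P ∈ U) :
    derivF (derivF fun p => (v.1 p).2.2) P = 0 := by
  have E := fun p r =>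
    determining_equation hv rfl rfl rfl hP p 0 r 0 0 (a := 1) (b := 0) (c := 0) (d := 1) (by simp)
  have hξ : EqOn (derivF fun p => (v.1 p).1) 0 U := fun P hP =>
    (derivF_eq_zero_of_isPointSymmetry hv hP).1
  have hη : EqOn (derivF fun p => (v.1 p).2.1) 0 U := fun P hP =>
    (derivF_eq_zero_of_isPointSymmetry hv hP).2
  have z : ∀ {g : PointSpace → ℝ}, EqOn g 0 U → EqOn (derivX g) 0 U ∧ EqOn (derivY g) 0 U ∧
      EqOn (derivF g) 0 U := fun hg =>
    ⟨dirDeriv_zero_of_eqOn U.2 hg _, dirDeriv_zero_of_eqOn U.2 hg _,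
      dirDeriv_zero_of_eqOn U.2 hg _⟩
  simp only [totalX, totalY, totalXX, totalXY, totalYY, totalXXX, totalXXY, totalXYY,
    totalYYY, hξ hP, hη hP, (z hξ).1 hP, (z hη).1 hP, (z hξ).2.1 hP, (z hη).2.1 hP,
    (z hξ).2.2 hP, (z hη).2.2 hP, Pi.zero_apply] at E
  have e11 := E 1 1
  have e10 := E 1 0
  have e01 := E 0 1
  have e00 := E 0 0
  -- Once the `f`-derivatives of `ξ` and `η` vanish on `U`, the only term in `p r` is `3 ζ_ff`, and
  -- the mixed difference extracts it.
  linear_combination (1 / 3) * (e11 - e10 - e01 + e00)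

theorem determining_relations {U : Opens PointSpace} {v : smoothVectorFields U}
    (hv : IsPointSymmetry U v) {ξ η ζ : PointSpace → ℝ} (hξ : ξ = fun p => (v.1 p).1)
    (hη : η = fun p => (v.1 p).2.1) (hζ : ζ = fun p => (v.1 p).2.2)
    {P : PointSpace} (hP : P ∈ U) :
    derivY ξ P = 0 ∧ derivX η P = 0 ∧ derivF ζ P = 3 / 2 * (derivX ξ P + derivY η P) ∧
    derivX (derivX (derivX ζ)) P = 0 ∧ derivY (derivX (derivX ζ)) P = 0 ∧
    derivY (derivY (derivX ζ)) P = 0 ∧ derivY (derivY (derivY ζ)) P = 0 := by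
  have E := fun a b c d h =>
    determining_equation hv hξ hη hζ hP 0 0 0 0 0 (a := a) (b := b) (c := c) (d := d) h
  simp only [totalX, totalY, totalXX, totalXY, totalYY, totalXXX, totalXXY, totalXYY,
    totalYYY] at E
  -- Changing the sign of `(a, b, c, d)` preserves `a d - b c = 1` and separates two parts. The odd
  -- part is `a ζ_yyy + d ζ_xxx - b ζ_xyy - c ζ_xxy`. The even part is `2 ζ_f - 3 (ξ_x + η_y) + 2 b²
  -- ξ_y - 2 a c ξ_y + 2 c² η_x - 2 b d η_x`, after use of the constraint. The seven choices suffice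
  -- to make all coefficients vanish.
  have e1 := E 1 0 0 1 (by norm_num)
  have e2 := E (-1) 0 0 (-1) (by norm_num)
  have e3 := E 2 0 0 (1 / 2) (by norm_num)
  have e4 := E 1 1 0 1 (by norm_num)
  have e5 := E (-1) (-1) 0 (-1) (by norm_num)
  have e6 := E 1 2 0 1 (by norm_num)
  have e7 := E 1 0 1 1 (by norm_num)
  have hk : derivF ζ P = 3 / 2 * (derivX ξ P + derivY η P) := by
    linear_combination (e1 + e2) / 4
  have hxxx : derivX (derivX (derivX ζ)) P = 0 := by
    linear_combination -(2 / 3) * (e3 - 2 * e1) - 2 / 3 * hk * 2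
  have hyyy : derivY (derivY (derivY ζ)) P = 0 := by
    linear_combination e1 - 2 * hk - hxxx
  have hd : derivX η P = derivY ξ P := by
    linear_combination -(e4 + e5) / 4 + hk
  have hxyy : derivY (derivY (derivX ζ)) P = 0 := by
    linear_combination (-(e4 - e5) / 2 + hxxx + hyyy)
  have hy : derivY ξ P = 0 := by
    linear_combination (e6 - 2 * hk - hxxx - hyyy + 2 * hxyy + 4 * hd) / 4
  have hx : derivX η P = 0 := hd.trans hy
  refine ⟨hy, hx, hk, hxxx, ?_, hxyy, hyyy⟩
  linear_combination -e7 + 2 * hk + hxxx + hyyy + 2 * hx - 2 * hy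

theorem second_order_relations {U : Opens PointSpace} {v : smoothVectorFields U}
    (hv : IsPointSymmetry U v) {ξ η ζ : PointSpace → ℝ} (hξ : ξ = fun p => (v.1 p).1)
    (hη : η = fun p => (v.1 p).2.1) (hζ : ζ = fun p => (v.1 p).2.2)
    {P : PointSpace} (hP : P ∈ U) :
    derivX (derivX ξ) P = 0 ∧ derivY (derivY η) P = 0 ∧ derivX (derivF ζ) P = 0 ∧
      derivY (derivF ζ) P = 0 := by
  have E := fun r t a b c d h =>
    determining_equation hv hξ hη hζ hP 0 0 r 0 t (a := a) (b := b) (c := c) (d := d) h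
  have hξf : EqOn (derivF ξ) 0 U := fun P hP =>
    hξ ▸ (derivF_eq_zero_of_isPointSymmetry hv hP).1
  have hηf : EqOn (derivF η) 0 U := fun P hP =>
    hη ▸ (derivF_eq_zero_of_isPointSymmetry hv hP).2
  have hζff : derivF (derivF ζ) P = 0 := hζ ▸ derivF_derivF_eq_zero_of_isPointSymmetry hv hP
  have hξy : EqOn (derivY ξ) 0 U := fun P hP => (determining_relations hv hξ hη hζ hP).1
  have hηx : EqOn (derivX η) 0 U := fun P hP => (determining_relations hv hξ hη hζ hP).2.1
  have hξyx : derivY (derivX ξ) P = 0 :=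
    dirDeriv_dirDeriv_eq_zero (hξ ▸ v.2.1.fst) hξy _ P hP
  have z : ∀ {g : PointSpace → ℝ} (e), EqOn g 0 U → dirDeriv e g P = 0 := fun e hg =>
    dirDeriv_zero_of_eqOn U.2 hg e hP
  have x1 : derivX (derivF ξ) P = 0 := z _ hξf
  have x2 : derivY (derivF ξ) P = 0 := z _ hξf
  have x3 : derivX (derivF η) P = 0 := z _ hηf
  have x4 : derivY (derivF η) P = 0 := z _ hηf
  have x5 : derivY (derivY ξ) P = 0 := z _ hξy
  have x6 : derivX (derivX η) P = 0 := z _ hηx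
  have x7 : derivY (derivX η) P = 0 := z _ hηx
  have x8 : derivF (derivF ξ) P = 0 := z _ hξf
  have x9 : derivF (derivF η) P = 0 := z _ hηf
  simp only [totalX, totalY, totalXX, totalXY, totalYY, totalXXX, totalXXY, totalXYY,
    totalYYY, hξf hP, hηf hP, hξyx, hζff, x1, x2, x3, x4, x5, x6, x7, x8, x9, Pi.zero_apply] at E
  -- Differences under `r ↦ -r` keep the part linear in `r`. It is `3 (ζ_xf - ξ_xx)` for `a = d =
  -- 1`, `b = c = 0`, and taking `c = 1` adds `-ζ_yf`, which is thereby isolated. Exchanging the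
  -- roles of `x` and `y` (varying `t`, with `b = 1`) isolates `ζ_xf`.
  have e1 := E 1 0 1 0 0 1 (by norm_num)
  have e2 := E (-1) 0 1 0 0 1 (by norm_num)
  have e3 := E 1 0 1 0 1 1 (by norm_num)
  have e4 := E (-1) 0 1 0 1 1 (by norm_num)
  have e5 := E 0 1 1 0 0 1 (by norm_num)
  have e6 := E 0 (-1) 1 0 0 1 (by norm_num)
  have e7 := E 0 1 1 1 0 1 (by norm_num)
  have e8 := E 0 (-1) 1 1 0 1 (by norm_num)
  have hy : derivY (derivF ζ) P = 0 := by linear_combination (e1 - e2 - e3 + e4) / 2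
  have hx : derivX (derivF ζ) P = 0 := by linear_combination (e5 - e6 - e7 + e8) / 2
  exact ⟨by linear_combination hx - (e1 - e2) / 6, by linear_combination hy - (e5 - e6) / 6, hx, hy⟩

/-! ### Integration of the determining equations -/

/-- On a connected open set two functions with the same gradient differ by a constant. The sharing
of `B` between the two hypotheses is the integrability condition. -/
theorem exists_eq_quadratic_of_derivs {U : Opens PointSpace}
    (hU : IsPreconnected (U : Set PointSpace))
    {g : PointSpace → ℝ} (hg : ContDiffOn ℝ ∞ g U) {α β κ A B C : ℝ}
    (hx : ∀ P ∈ U, derivX g P = α + A * P.1 + B * P.2.1)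
    (hy : ∀ P ∈ U, derivY g P = β + B * P.1 + C * P.2.1) (hf : ∀ P ∈ U, derivF g P = κ) :
    ∃ k, ∀ P ∈ U, g P = k + (α * P.1 + β * P.2.1 + κ * P.2.2 + A / 2 * P.1 ^ 2 +
      B * (P.1 * P.2.1) + C / 2 * P.2.1 ^ 2) := by
  set H : PointSpace → ℝ := fun P => α * P.1 + β * P.2.1 + κ * P.2.2 + A / 2 * P.1 ^ 2 +
      B * (P.1 * P.2.1) + C / 2 * P.2.1 ^ 2 with hH
  have hHs : Differentiable ℝ H := by fun_prop
  have hgd : DifferentiableOn ℝ g U := hg.differentiableOn (by simp)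
  obtain ⟨k, hk⟩ := U.2.exists_eq_add_of_fderiv_eq hU hgd hHs.differentiableOn fun P hP => by
    have h1 : HasFDerivAt (fun P : PointSpace => P.1) (ContinuousLinearMap.fst ℝ ℝ (ℝ × ℝ)) P :=
      hasFDerivAt_fst
    have h23 : HasFDerivAt (fun P : PointSpace => P.2) (ContinuousLinearMap.snd ℝ ℝ (ℝ × ℝ)) P :=
      hasFDerivAt_snd
    have h2 := h23.fst
    have h3 := h23.snd
    have hd : HasFDerivAt H _ P := (((((h1.const_mul α).add (h2.const_mul β)).add
      (h3.const_mul κ)).add ((h1.pow 2).const_mul (A / 2))).add ((h1.mul h2).const_mul B)).add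
      ((h2.pow 2).const_mul (C / 2))
    rw [hd.fderiv]
    have ex : fderiv ℝ g P (1, 0) = _ := hx P hP
    have ey : fderiv ℝ g P (0, 1, 0) = _ := hy P hP
    have ef : fderiv ℝ g P (0, 0, 1) = _ := hf P hP
    ext
    · simp [ex]; ring
    · simp [ey]; ring
    · simp [ef]
  exact ⟨k, fun P hP => by rw [hk hP]; simp only [hH]; ring⟩

theorem exists_eq_const_of_derivs {U : Opens PointSpace} (hU : IsPreconnected (U : Set PointSpace))
    {g : PointSpace → ℝ} (hg : ContDiffOn ℝ ∞ g U) (hx : ∀ P ∈ U, derivX g P = 0)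
    (hy : ∀ P ∈ U, derivY g P = 0) (hf : ∀ P ∈ U, derivF g P = 0) :
    ∃ k, ∀ P ∈ U, g P = k := by
  obtain ⟨k, hk⟩ := exists_eq_quadratic_of_derivs hU hg (α := 0) (β := 0) (A := 0) (B := 0) (C := 0)
    (by simpa using hx) (by simpa using hy) hf
  exact ⟨k, by simpa using hk⟩

theorem exists_eq_generatorCombo {U : Opens PointSpace} (hU : IsPreconnected (U : Set PointSpace))
    {v : smoothVectorFields U} (hv : IsPointSymmetry U v) :
    ∃ c, ∀ P ∈ U, v.1 P = generatorCombo c P := by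
  obtain ⟨ξ, hξ⟩ : ∃ ξ, ξ = fun p => (v.1 p).1 := ⟨_, rfl⟩
  obtain ⟨η, hη⟩ : ∃ η, η = fun p => (v.1 p).2.1 := ⟨_, rfl⟩
  obtain ⟨ζ, hζ⟩ : ∃ ζ, ζ = fun p => (v.1 p).2.2 := ⟨_, rfl⟩
  have hsξ : ContDiffOn ℝ ∞ ξ U := hξ ▸ v.2.1.fst
  have hsη : ContDiffOn ℝ ∞ η U := hη ▸ v.2.1.snd.fst
  have hsζ : ContDiffOn ℝ ∞ ζ U := hζ ▸ v.2.1.snd.snd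
  have sX : ∀ {g}, ContDiffOn ℝ ∞ g U → ContDiffOn ℝ ∞ (derivX g) U := fun hg =>
    hg.dirDeriv U.2 _
  have sY : ∀ {g}, ContDiffOn ℝ ∞ g U → ContDiffOn ℝ ∞ (derivY g) U := fun hg =>
    hg.dirDeriv U.2 _
  have zero : ∀ {g : PointSpace → ℝ} (e), EqOn g 0 U → EqOn (dirDeriv e g) 0 U := fun e hg =>
    dirDeriv_zero_of_eqOn U.2 hg e
  have R := fun P (hP : P ∈ U) => determining_relations hv hξ hη hζ hP
  have S := fun P (hP : P ∈ U) => second_order_relations hv hξ hη hζ hP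
  have hξf : ∀ P ∈ U, derivF ξ P = 0 := fun P hP =>
    hξ ▸ (derivF_eq_zero_of_isPointSymmetry hv hP).1
  have hηf : ∀ P ∈ U, derivF η P = 0 := fun P hP =>
    hη ▸ (derivF_eq_zero_of_isPointSymmetry hv hP).2
  have hξy : ∀ P ∈ U, derivY ξ P = 0 := fun P hP => (R P hP).1
  have hηx : ∀ P ∈ U, derivX η P = 0 := fun P hP => (R P hP).2.1
  obtain ⟨k₂, hk₂⟩ := exists_eq_const_of_derivs hU (sX hsξ) (fun P hP => (S P hP).1)
    (dirDeriv_dirDeriv_eq_zero hsξ hξy _) (dirDeriv_dirDeriv_eq_zero hsξ hξf _)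
  obtain ⟨k₃, hk₃⟩ := exists_eq_const_of_derivs hU (sY hsη)
    (dirDeriv_dirDeriv_eq_zero hsη hηx _) (fun P hP => (S P hP).2.1)
    (dirDeriv_dirDeriv_eq_zero hsη hηf _)
  obtain ⟨k₀, hk₀⟩ := exists_eq_quadratic_of_derivs hU hsξ (α := k₂) (β := 0) (κ := 0) (A := 0)
    (B := 0) (C := 0) (by simpa using hk₂) (by simpa using hξy) hξf
  obtain ⟨k₁, hk₁⟩ := exists_eq_quadratic_of_derivs hU hsη (α := 0) (β := k₃) (κ := 0) (A := 0)
    (B := 0) (C := 0) (by simpa using hηx) (by simpa using hk₃) hηf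
  have hζf : ∀ P ∈ U, derivF ζ P = 3 / 2 * (k₂ + k₃) := fun P hP => by
    rw [(R P hP).2.2.1, hk₂ P hP, hk₃ P hP]
  have hζfx : EqOn (derivF (derivX ζ)) 0 U := fun P hP =>
    (dirDeriv_comm U.2 hsζ _ _ hP).trans (S P hP).2.2.1
  have hζfy : EqOn (derivF (derivY ζ)) 0 U := fun P hP =>
    (dirDeriv_comm U.2 hsζ _ _ hP).trans (S P hP).2.2.2
  have hζxy : EqOn (derivX (derivY ζ)) (derivY (derivX ζ)) U := dirDeriv_comm U.2 hsζ _ _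
  -- The second derivatives of `ζ` in `x, y` are constant: their `x`- and `y`-derivatives are the
  -- vanishing third derivatives, and their `f`-derivative vanishes because `ζ_xf = ζ_yf = 0` on
  -- `U`. Two further integrations recover `ζ`.
  obtain ⟨A, hA⟩ := exists_eq_const_of_derivs hU (sX (sX hsζ)) (fun P hP => (R P hP).2.2.2.1)
    (fun P hP => (R P hP).2.2.2.2.1) (dirDeriv_dirDeriv_eq_zero (sX hsζ) hζfx _)
  obtain ⟨B, hB⟩ := exists_eq_const_of_derivs hU (sY (sX hsζ))
    (fun P hP => (dirDeriv_comm U.2 (sX hsζ) _ _ hP).trans (R P hP).2.2.2.2.1)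
    (fun P hP => (R P hP).2.2.2.2.2.1) (dirDeriv_dirDeriv_eq_zero (sX hsζ) hζfx _)
  obtain ⟨C, hC⟩ := exists_eq_const_of_derivs hU (sY (sY hsζ))
    (fun P hP => (dirDeriv_comm U.2 (sY hsζ) _ _ hP).trans
      ((dirDeriv_congr U.2 hζxy _ hP).trans (R P hP).2.2.2.2.2.1))
    (fun P hP => (R P hP).2.2.2.2.2.2) (dirDeriv_dirDeriv_eq_zero (sY hsζ) hζfy _)
  obtain ⟨α, hα⟩ := exists_eq_quadratic_of_derivs hU (sX hsζ) (α := A) (β := B) (κ := 0) (A := 0)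
    (B := 0) (C := 0) (by simpa using hA) (by simpa using hB) hζfx
  obtain ⟨β, hβ⟩ := exists_eq_quadratic_of_derivs hU (sY hsζ) (α := B) (β := C) (κ := 0) (A := 0)
    (B := 0) (C := 0) (fun P hP => by simpa using (hζxy hP).trans (hB P hP)) (by simpa using hC)
    hζfy
  obtain ⟨k, hk⟩ := exists_eq_quadratic_of_derivs hU hsζ (α := α) (β := β) (A := A) (B := B)
    (C := C) (fun P hP => by rw [hα P hP]; ring) (fun P hP => by rw [hβ P hP]; ring) hζf
  refine ⟨![k₀, k₁, k₂, k₃, B, A / 2, C / 2, α, β, k], fun P hP => ?_⟩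
  have e1 : (v.1 P).1 = ξ P := by rw [hξ]
  have e2 : (v.1 P).2.1 = η P := by rw [hη]
  have e3 : (v.1 P).2.2 = ζ P := by rw [hζ]
  ext
  · rw [e1, hk₀ P hP]; simp [generatorCombo]
  · rw [e2, hk₁ P hP]; simp [generatorCombo]
  · rw [e3, hk P hP]; simp [generatorCombo]; ring

/-! ### The symmetry algebra and its tables -/

theorem mainTheorem1 (U : Opens PointSpace) (hU : IsConnected (U : Set PointSpace)) :
    ∃ L : LieSubalgebra ℝ (smoothVectorFields U),
      (∀ v : smoothVectorFields U, v ∈ L ↔ IsPointSymmetry U v) ∧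
      Module.finrank ℝ L = 10 ∧
      L.toSubmodule = Submodule.span ℝ (Set.range (generator U)) ∧
      (∀ i j : Fin 10, ⁅generator U i, generator U j⁆ =
        commutatorTable (generator U 0) (generator U 1) (generator U 2) (generator U 3)
          (generator U 4) (generator U 5) (generator U 6) (generator U 7) (generator U 8)
          (generator U 9) i j) ∧
      (∀ (ε : ℝ) (i j : Fin 10), IsAdjointAction ε (generator U i) (generator U j)
        (adjointTable ε (generator U 0) (generator U 1) (generator U 2) (generator U 3)
          (generator U 4) (generator U 5) (generator U 6) (generator U 7) (generator U 8)
          (generator U 9) i j)) := by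
  refine ⟨generatorLieSubalgebra U, fun v => ?_, ?_, rfl, bracket_generator U,
    isAdjointAction_generator U⟩
  · refine (mem_span_generator_iff U v).trans ⟨?_, exists_eq_generatorCombo hU.isPreconnected⟩
    rintro ⟨c, hc⟩
    exact isPointSymmetry_of_eqOn_generatorCombo U v c hc
  · exact (finrank_span_eq_card (linearIndependent_generator U hU.nonempty)).trans (by simp)
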